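/- **Setting.** Let $E\subset\mathbb{C}$ be open with $0\in E$, let $f:E\to\mathbb{C}$ be holomorphic, and let $K\subset E$ be a nonempty compact set without isolated points. Let $m,n\ge 0$ be integers. For integers $k,l$ let $\mathcal{R}_{kl}$ be the set of rational functions $r=p/q$ with complex polynomials $p,q$, $\deg p\le k$, $\deg q\le l$, $q\not\equiv 0$ (where $\deg 0=-\infty$). For a set $A\subset E$ and a rational function $r$, put $\|r-f\|_A=\sup_{z\in A}|r(z)-f(z)|$, which is $\infty$ if $r$ has a pole in $A$. Let $\Delta$ be the closed unit disk and $\varepsilon A=\{\varepsilon z: z\in A\}$. For nodes $z_0,\dots,z_{m+n}\in E$ (repetitions allowed), $r\in\mathcal{R}_{mn}$ is a *Newton–Padé approximant* to $f$ if $r=p/q$ with $p,q$ as above ($k=m$, $l=n$) such that $p(z)-q(z)f(z)=\tilde v(z)\prod_{j=0}^{m+n}(z-z_j)$ on $E$ with $\tilde v$ holomorphic on $E$; the $(m,n)$-*Padé approximant* $r^P$ is the case $z_0=\dots=z_{m+n}=0$. For $\Theta\subset\mathbb{C}$ let $\mathcal{I}_{mn}^{\Theta}$ be the set of all $r\in\mathcal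 R_{mn}$ that are Newton–Padé approximants to $f$ for some nodes $z_0,\dots,z_{m+n}\in\Theta\cap E$. A function $r\in\mathcal R_{mn}$ is *non-degenerate* if there is no integer $d>0$ with $r\in\mathcal R_{m-d,n-d}$. For $k\ge 0$ let $t_k=\min_{\zeta_1,\dots,\zeta_k\in\mathbb{C}}\ \max_{z\in K}\prod_{j=1}^{k}|z-\zeta_j|$ (so $t_0=1$), and put $$\rho = 2\,\frac{t_{m+n+1}}{t_{m+n}}+\max_{z\in K}|z| .$$ **Proposition.** Assume that the Padé approximant $r^P$ is non-degenerate and that $r^P(z)-f(z)=a_{mn}z^{m+n+1}+\mathcal{O}(z^{m+n+2})$ as $z\to0$ with $a_{mn}\ne 0$. Then $\rho>0$, and there is $\varepsilon_0>0$ such that for every $\varepsilon\in(0,\varepsilon_0)$, with $\Theta=\rho\Delta$, one has $\varepsilon K\subset E$, $\varepsilon\Theta\subset E$, and: 1. for every $(m,n)$-rational Chebyshev approximant $r^\varepsilon$ to $f$ on $\varepsilon K$, i.e. every $r^\varepsilon\in\mathcal R_{mn}$ with $\|r^\varepsilon-f\|_{\varepsilon K}=\min_{r\in\mathcal R_{mn}}\|r-f\|_{\varepsilon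 K}$, the difference $r^\varepsilon-f$ has exactly $m+n+1$ zeros in $\varepsilon\rho\Delta$, counting multiplicity; 2. Chebyshev approximation on $\varepsilon K$ coincides with interpolatory best approximation with $\Theta=\rho\Delta$: a rational function $r$ is an $(m,n)$-rational Chebyshev approximant to $f$ on $\varepsilon K$ if and only if $r\in\mathcal I_{mn}^{\varepsilon\Theta}$ and $\|r-f\|_{\varepsilon K}=\min_{s\in\mathcal I_{mn}^{\varepsilon\Theta}}\|s-f\|_{\varepsilon K}$. -/

import Mathlib

open scoped Pointwise Topology ENNReal

noncomputable section

namespace RationalApprox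

/-- `p` is a polynomial of degree at most `k`, for an integer `k`. As usual the zero polynomial has
degree `-∞`, so for negative `k` the zero polynomial is the only one. -/
def DegreeAtMost (k : ℤ) (p : Polynomial ℂ) : Prop :=
  p ≠ 0 → (p.natDegree : ℤ) ≤ k

/-- The value at `z` of a rational function. (At a pole Mathlib's convention gives the
value `0`; poles are treated separately in `uniformError`, and the resulting function is not
continuous at a pole.) -/
def value (r : RatFunc ℂ) (z : ℂ) : ℂ :=
  r.eval (RingHom.id ℂ) z

/-- `z` is a pole of `r`: a zero of the denominator of `r` in lowest terms. -/
def IsPole (r : RatFunc ℂ) (z : ℂ) : Prop :=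
  r.denom.IsRoot z

/-- `r = p / q` for the polynomials `p` and `q`, where `p` has degree at most `m`, and `q` is not
identically zero and has degree at most `n`. -/
def IsQuotient (m n : ℤ) (r : RatFunc ℂ) (p q : Polynomial ℂ) : Prop :=
  DegreeAtMost m p ∧ DegreeAtMost n q ∧ q ≠ 0 ∧
    r = algebraMap (Polynomial ℂ) (RatFunc ℂ) p / algebraMap (Polynomial ℂ) (RatFunc ℂ) q

/-- The set `R_{mn}` of `(m, n)`-rational functions. -/
def rationals (m n : ℤ) : Set (RatFunc ℂ) :=
  {r | ∃ p q : Polynomial ℂ, IsQuotient m n r p q}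

/-- The defect of `r` in `R_{mn}`, i.e. the largest `d ≥ 0` with `r ∈ R_{m-d,n-d}`, is zero. -/
def IsNondegenerate (m n : ℕ) (r : RatFunc ℂ) : Prop :=
  r ∈ rationals m n ∧ ∀ d : ℕ, r ∈ rationals (m - d) (n - d) → d = 0

/-- `r` is the `(m, n)` Newton-Padé approximant to `f : E → ℂ` for the nodes `z 0, …, z (m + n)`
(repetitions allowed): `r = p / q` where `p - q f` is the product of a holomorphic function on `E`
and of the nodal polynomial. -/
def IsNewtonPade (E : Set ℂ) (f : ℂ → ℂ) (m n : ℕ) (z : Fin (m + n + 1) → ℂ)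
    (r : RatFunc ℂ) : Prop :=
  (∀ j, z j ∈ E) ∧ ∃ p q : Polynomial ℂ, IsQuotient m n r p q ∧
    ∃ v : ℂ → ℂ, DifferentiableOn ℂ v E ∧
      ∀ w ∈ E, p.eval w - q.eval w * f w = v w * ∏ j, (w - z j)

/-- The `(m, n)`-Padé approximant: all nodes are at the origin. -/
def IsPade (E : Set ℂ) (f : ℂ → ℂ) (m n : ℕ) (r : RatFunc ℂ) : Prop :=
  IsNewtonPade E f m n (fun _ => 0) r

/-- `a` is the leading coefficient of the error of the Padé approximant `r`:
`r(z) - f(z) = a z ^ (m + n + 1) + O(z ^ (m + n + 2))` as `z → 0`. -/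
def IsErrorCoeff (f : ℂ → ℂ) (m n : ℕ) (r : RatFunc ℂ) (a : ℂ) : Prop :=
  (fun z : ℂ => value r z - f z - a * z ^ (m + n + 1)) =O[𝓝 0] fun z : ℂ => z ^ (m + n + 2)

open Classical in
/-- The uniform error `‖r - f‖_K`, which is `∞` if `r` has a pole in `K`. -/
def uniformError (K : Set ℂ) (f : ℂ → ℂ) (r : RatFunc ℂ) : ℝ≥0∞ :=
  ⨆ z ∈ K, if IsPole r z then ⊤ else ‖value r z - f z‖ₑ

/-- `r` minimizes the uniform error to `f` on `K` among the members of `S`. -/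
def IsBestIn (S : Set (RatFunc ℂ)) (K : Set ℂ) (f : ℂ → ℂ) (r : RatFunc ℂ) : Prop :=
  r ∈ S ∧ ∀ s ∈ S, uniformError K f r ≤ uniformError K f s

/-- `r` is an `(m, n)`-rational Chebyshev approximant to `f` on `K`. -/
def IsChebyshev (m n : ℕ) (K : Set ℂ) (f : ℂ → ℂ) (r : RatFunc ℂ) : Prop :=
  IsBestIn (rationals m n) K f r

/-- The set of `(m, n)`-rational functions which interpolate `f : E → ℂ` in the Newton-Padé sense
at some `m + n + 1` nodes in `Θ`, counting multiplicity. -/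
def interpolants (E : Set ℂ) (f : ℂ → ℂ) (m n : ℕ) (Θ : Set ℂ) : Set (RatFunc ℂ) :=
  {r | ∃ z : Fin (m + n + 1) → ℂ, (∀ j, z j ∈ Θ) ∧ IsNewtonPade E f m n z r}

/-- `r` is an interpolatory best approximant to `f` on `K` with nodes in `Θ`. -/
def IsInterpolatoryBest (E : Set ℂ) (m n : ℕ) (Θ K : Set ℂ) (f : ℂ → ℂ) (r : RatFunc ℂ) : Prop :=
  IsBestIn (interpolants E f m n Θ) K f r

/-- The Chebyshev constant `t_k` of `K`: the minimum over all `ζ_1, …, ζ_k ∈ ℂ` of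
`max_{z ∈ K} ∏ |z - ζ_j|`. (For nonempty `K` one has `t_0 = 1`.) -/
def chebyshevConst (K : Set ℂ) (k : ℕ) : ℝ :=
  ⨅ ζ : Fin k → ℂ, ⨆ z : K, ∏ j, ‖(z : ℂ) - ζ j‖

/-- The radius `2 t_{m+n+1} / t_{m+n} + max_{z ∈ K} |z|`. -/
def nodeRadius (K : Set ℂ) (m n : ℕ) : ℝ :=
  2 * (chebyshevConst K (m + n + 1) / chebyshevConst K (m + n)) + ⨆ z : K, ‖(z : ℂ)‖

/-- `g` has exactly `N` zeros in `D`, counting multiplicity: the zeros in `D`, repeated according to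
their order of vanishing, form a multiset with `N` elements. -/
def HasExactlyZeros (g : ℂ → ℂ) (D : Set ℂ) (N : ℕ) : Prop :=
  ∃ Z : Multiset ℂ, Multiset.card Z = N ∧ (∀ z ∈ Z, z ∈ D) ∧
    ∀ z ∈ D, analyticOrderAt g z = (Z.count z : ℕ∞)

end RationalApprox

end

open scoped Pointwise Topology ENNReal

noncomputable section

namespace RationalApprox

/-! ### Zeros of holomorphic functions in a disc: division by nodal polynomials and Rouché's
theorem. -/

section

open Complex Metric

/-! Put `N = m + n + 1` and `r^P = P/Q` in lowest terms with `Q(0) = 1`. Non-degeneracy means that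
`P` or `Q` has full degree, so `(p, q) ↦ pQ - Pq` maps the pairs of degrees at most `m`, `n` onto
the polynomials of degree at most `m + n`, with kernel spanned by `(P, Q)` (`IsLocalFrame`). Hence
rational functions near `r^P` are parametrized by the numerator of `r - r^P`, written as `a ε^N ∑
x_k (z/ε)^k` with `x ∈ ℂ^N`.

In this parametrization, `r(εw) - f(εw) = a ε^N (w^N + ∑ x_k w^k) + o(ε^N)`, uniformly for bounded
`x` and `|w| ≤ ρ` (`IsLocalFrame.eventually_norm_nearby_sub_le`). To leading order, approximation on
`εK` is therefore the Chebyshev problem for monic polynomials of degree `N` on `K`. Conversely, an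
error `O(ε^N)` on `εK` forces `r` into this family with `x` in a fixed ball
(`IsLocalFrame.exists_eventually_eq_nearby`). Compactness of the ball then gives existence of a best
approximant.

Comparison with nearly optimal nodes shows that the monic polynomial of a best approximant is at
most `(7/4) t_N` on `K`. Its zeros then have modulus at most `ρ - t_N / (4 t_{N-1})`, because
dividing out a more distant zero would leave a monic polynomial of degree `N - 1` with maximum below
`t_{N-1}` (`norm_root_le_of_nodal_le`). Rouché's theorem on `|z| = ερ` gives exactly `N` zeros of `r
- f`, which serve as interpolation nodes. So every Chebyshev approximant lies in the smaller class
of interpolants, and the two minimization problems have the same solutions. -/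

theorem analyticOrderAt_multiset_prod (Z : Multiset ℂ) (z : ℂ) :
    AnalyticAt ℂ (fun w : ℂ => (Z.map (fun ζ => w - ζ)).prod) z ∧
      analyticOrderAt (fun w : ℂ => (Z.map (fun ζ => w - ζ)).prod) z = (Z.count z : ℕ∞) := by
  induction Z using Multiset.induction_on with
  | empty =>
    refine ⟨by simpa using analyticAt_const, ?_⟩
    simp [analyticOrderAt_eq_zero]
  | cons b Z ih =>
    have hb : AnalyticAt ℂ (fun w : ℂ => w - b) z := by fun_prop
    have e : (fun w : ℂ => ((b ::ₘ Z).map (fun ζ => w - ζ)).prod) =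
        (fun w : ℂ => w - b) * fun w : ℂ => (Z.map (fun ζ => w - ζ)).prod := by
      ext w; simp
    rw [e]
    refine ⟨hb.mul ih.1, ?_⟩
    rw [analyticOrderAt_mul hb ih.1, ih.2]
    by_cases h : z = b
    · subst h
      have : analyticOrderAt (fun w : ℂ => w - z) z = 1 := analyticOrderAt_id_sub_const_self
      rw [this]; simp [add_comm]
    · have : analyticOrderAt (fun w : ℂ => w - b) z = 0 := by
        simp [h]
      rw [this]; simp [h]

/-- A holomorphic function is divisible by the nodal polynomial of a multiset of zeros. -/
theorem exists_eq_mul_multiset_prod {E : Set ℂ} (hE : IsOpen E) (Z : Multiset ℂ) :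
    ∀ {g : ℂ → ℂ}, DifferentiableOn ℂ g E → (∀ z ∈ Z, z ∈ E) →
      (∀ z ∈ Z, (Z.count z : ℕ∞) ≤ analyticOrderAt g z) →
      ∃ v : ℂ → ℂ, DifferentiableOn ℂ v E ∧
        ∀ w ∈ E, g w = v w * (Z.map (fun ζ => w - ζ)).prod := by
  induction Z using Multiset.induction_on with
  | empty => intro g hg _ _; exact ⟨g, hg, by simp⟩
  | cons b Z ih =>
    intro g hg hZ hord
    have hbE : b ∈ E := hZ b (by simp)
    have hgb : g b = 0 := by
      apply apply_eq_zero_of_analyticOrderAt_ne_zero (𝕜 := ℂ)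
      have := hord b (by simp)
      intro h0
      rw [h0] at this
      simp at this
    -- Since `g b = 0`, the slope function is the quotient of `g` by `w - b`. Its order drops by one
    -- at `b` and is unchanged elsewhere, as the induction requires.
    have hd : DifferentiableOn ℂ (dslope g b) E :=
      (Complex.differentiableOn_dslope (hE.mem_nhds hbE)).2 hg
    have e : g = (fun w => w - b) * dslope g b := by
      ext w
      have := sub_smul_dslope g b w
      simp only [smul_eq_mul, hgb, sub_zero] at this
      simp [this]
    obtain ⟨v, hv, hv'⟩ := ih hd (fun z hz => hZ z (by simp [hz])) (by
      intro z hz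
      have h1 := hord z (by simp [hz])
      have hzE := hZ z (by simp [hz])
      have hb : AnalyticAt ℂ (fun w : ℂ => w - b) z := by fun_prop
      have ha : AnalyticAt ℂ (dslope g b) z := hd.analyticAt (hE.mem_nhds hzE)
      have e2 : analyticOrderAt g z = _ :=
        (congrArg (fun F => analyticOrderAt F z) e).trans (analyticOrderAt_mul hb ha)
      rw [e2] at h1
      by_cases h : z = b
      · subst h
        have h2 : analyticOrderAt (fun w : ℂ => w - z) z = 1 := analyticOrderAt_id_sub_const_self
        rw [h2, Multiset.count_cons_self, add_comm 1] at h1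
        push_cast at h1
        exact (ENat.add_le_add_iff_right (by simp)).1 h1
      · have h2 : analyticOrderAt (fun w : ℂ => w - b) z = 0 := by
          simp [h]
        rwa [h2, Multiset.count_cons_of_ne h, zero_add] at h1)
    refine ⟨v, hv, fun w hw => ?_⟩
    have h1 : g w = (w - b) * dslope g b w := congrFun e w
    rw [h1, hv' w hw, Multiset.map_cons, Multiset.prod_cons]
    ring

/-- A holomorphic function without zeros on a circle is, up to a factor without zeros in the closed
disc, the nodal polynomial of a multiset in the open disc. -/
theorem exists_zeros_multiset {E : Set ℂ} (hE : IsOpen E) {R : ℝ} (hR : 0 < R)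
    (hRE : closedBall 0 R ⊆ E) {g : ℂ → ℂ} (hg : DifferentiableOn ℂ g E)
    (hg0 : ∀ z ∈ sphere (0 : ℂ) R, g z ≠ 0) :
    ∃ (Z : Multiset ℂ) (v : ℂ → ℂ), (∀ z ∈ Z, z ∈ ball (0 : ℂ) R) ∧ DifferentiableOn ℂ v E ∧
      (∀ w ∈ E, g w = v w * (Z.map (fun ζ => w - ζ)).prod) ∧
      ∀ w ∈ closedBall (0 : ℂ) R, v w ≠ 0 := by
  classical
  have hgA : ∀ z ∈ E, AnalyticAt ℂ g z := fun z hz => hg.analyticAt (hE.mem_nhds hz)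
  have hRs : (R : ℂ) ∈ sphere (0 : ℂ) R := by simp [abs_of_pos hR]
  have hfin : ∀ z ∈ closedBall (0 : ℂ) R, analyticOrderAt g z ≠ ⊤ := by
    intro z hz
    -- Identity theorem: an infinite order anywhere in the disc would spread to the boundary point
    -- `R`, where `g` does not vanish.
    refine AnalyticOnNhd.analyticOrderAt_ne_top_of_isPreconnected (U := closedBall (0 : ℂ) R)
      (fun z hz => hgA z (hRE hz)) (convex_closedBall _ _).isPreconnected
      (sphere_subset_closedBall hRs) hz ?_
    have : analyticOrderAt g (R : ℂ) = 0 := by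
      rw [analyticOrderAt_eq_zero]; exact Or.inr (hg0 _ hRs)
    simp [this]
  have hS : {z ∈ closedBall (0 : ℂ) R | g z = 0}.Finite := by
    by_contra hinf
    obtain ⟨x, hx, hacc⟩ := Set.Infinite.exists_accPt_of_subset_isCompact hinf
      (isCompact_closedBall (0 : ℂ) R) (fun z hz => hz.1)
    apply hfin x hx
    rw [analyticOrderAt_eq_top]
    apply ((hgA x (hRE hx)).frequently_zero_iff_eventually_zero).1
    rw [accPt_iff_frequently_nhdsNE] at hacc
    exact hacc.mono fun z hz => hz.2
  let S := hS.toFinset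
  let Z : Multiset ℂ := ∑ z ∈ S, (analyticOrderNatAt g z) • {z}
  have hcount : ∀ z, Z.count z = if z ∈ S then analyticOrderNatAt g z else 0 := by
    intro z
    simp only [Z, Multiset.count_sum', Multiset.count_nsmul, Multiset.count_singleton]
    simp
  have hmem : ∀ z ∈ Z, z ∈ S := by
    intro z hz
    have := Multiset.count_pos.2 hz
    rw [hcount] at this
    by_contra h
    simp [h] at this
  have hSb : ∀ z ∈ S, z ∈ ball (0 : ℂ) R := by
    intro z hz
    have hz' : z ∈ closedBall (0 : ℂ) R ∧ g z = 0 := by simpa [S] using hz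
    rw [mem_ball]
    refine lt_of_le_of_ne hz'.1 fun h => hg0 z h hz'.2
  have horder : ∀ z ∈ S, (Z.count z : ℕ∞) = analyticOrderAt g z := by
    intro z hz
    rw [hcount, if_pos hz, Nat.cast_analyticOrderNatAt (hfin z (ball_subset_closedBall (hSb z hz)))]
  obtain ⟨v, hv, hgv⟩ := exists_eq_mul_multiset_prod hE Z hg
    (fun z hz => hRE (ball_subset_closedBall (hSb z (hmem z hz))))
    (fun z hz => (horder z (hmem z hz)).le)
  refine ⟨Z, v, fun z hz => hSb z (hmem z hz), hv, hgv, fun w hw => ?_⟩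
  by_cases hwS : w ∈ S
  · have h1 := horder w hwS
    have hva : AnalyticAt ℂ v w := hv.analyticAt (hE.mem_nhds (hRE hw))
    have hp := analyticOrderAt_multiset_prod Z w
    have h2 : analyticOrderAt g w = analyticOrderAt v w + Z.count w := by
      rw [← hp.2, ← analyticOrderAt_mul hva hp.1]
      apply analyticOrderAt_congr
      filter_upwards [hE.mem_nhds (hRE hw)] with y hy using hgv y hy
    have h3 : analyticOrderAt v w = 0 := by
      rw [h2] at h1
      have : (0 : ℕ∞) + Z.count w = analyticOrderAt v w + Z.count w := by rw [zero_add]; exact h1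
      exact le_antisymm ((ENat.add_le_add_iff_right (by simp)).1 this.ge) zero_le
    exact hva.analyticOrderAt_eq_zero.1 h3
  · intro h
    apply hwS
    simp only [S, Set.Finite.mem_toFinset]
    exact ⟨hw, by rw [hgv w (hRE hw), h, zero_mul]⟩

theorem continuousOn_logDeriv_sphere {E : Set ℂ} (hE : IsOpen E) {R : ℝ}
    (hRE : sphere 0 R ⊆ E) {g : ℂ → ℂ} (hg : DifferentiableOn ℂ g E)
    (hg0 : ∀ z ∈ sphere (0 : ℂ) R, g z ≠ 0) : ContinuousOn (logDeriv g) (sphere 0 R) :=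
  ((hg.deriv hE).continuousOn.mono hRE).div (hg.continuousOn.mono hRE) hg0

/-- The argument principle for a function already factored. The zero-free factor has a holomorphic
logarithmic derivative, which integrates to zero, and each linear factor adds `1 / (z - b)`. -/
theorem circleIntegral_logDeriv_mul_prod {E : Set ℂ} (hE : IsOpen E) {R : ℝ} (hR : 0 < R)
    (hRE : closedBall 0 R ⊆ E) {v : ℂ → ℂ} (hv : DifferentiableOn ℂ v E)
    (hv0 : ∀ z ∈ closedBall (0 : ℂ) R, v z ≠ 0) (Z : Multiset ℂ)
    (hZ : ∀ z ∈ Z, z ∈ ball (0 : ℂ) R) :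
    (∮ z in C(0, R), logDeriv (fun w => v w * (Z.map (fun ζ => w - ζ)).prod) z) =
      2 * Real.pi * I * Multiset.card Z := by
  induction Z using Multiset.induction_on with
  | empty =>
    simp only [Multiset.map_zero, Multiset.prod_zero, mul_one, Multiset.card_zero, Nat.cast_zero,
      mul_zero]
    apply DiffContOnCl.circleIntegral_eq_zero hR.le
    apply DifferentiableOn.diffContOnCl
    rw [closure_ball _ hR.ne']
    exact ((hv.deriv hE).mono hRE).div (hv.mono hRE) hv0
  | cons b Z ih =>
    have hb := hZ b (by simp)
    have hZ' : ∀ z ∈ Z, z ∈ ball (0 : ℂ) R := fun z hz => hZ z (by simp [hz])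
    set F : ℂ → ℂ := fun w => v w * (Z.map (fun ζ => w - ζ)).prod with hF
    have hFd : DifferentiableOn ℂ F E := fun z hz =>
      (hv z hz).mul (analyticOrderAt_multiset_prod Z z).1.differentiableAt.differentiableWithinAt
    have hne : ∀ z ∈ sphere (0 : ℂ) R, ∀ ζ ∈ ball (0 : ℂ) R, z - ζ ≠ 0 := by
      intro z hz ζ hζ h
      rw [sub_eq_zero] at h
      subst h
      rw [mem_sphere] at hz
      rw [mem_ball] at hζ
      exact hζ.ne hz
    have hF0 : ∀ z ∈ sphere (0 : ℂ) R, F z ≠ 0 := by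
      intro z hz
      refine mul_ne_zero (hv0 z (sphere_subset_closedBall hz)) ?_
      rw [Ne, Multiset.prod_eq_zero_iff, Multiset.mem_map]
      rintro ⟨ζ, hζ, h⟩
      exact hne z hz ζ (hZ' ζ hζ) h
    have hcongr : Set.EqOn
        (logDeriv (fun w => v w * ((b ::ₘ Z).map (fun ζ => w - ζ)).prod))
        (fun z => (z - b)⁻¹ + logDeriv F z) (sphere 0 R) := by
      intro z hz
      have e : (fun w => v w * ((b ::ₘ Z).map (fun ζ => w - ζ)).prod) =
          fun w => (w - b) * F w := by
        ext w; simp [hF]; ring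
      rw [e]
      rw [logDeriv_mul z (hne z hz b hb) (hF0 z hz) (by fun_prop)
        ((hFd z (hRE (sphere_subset_closedBall hz))).differentiableAt
          (hE.mem_nhds (hRE (sphere_subset_closedBall hz))))]
      simp [logDeriv_apply]
    rw [circleIntegral.integral_congr hR.le hcongr, circleIntegral.integral_add, ih hZ',
      circleIntegral.integral_sub_inv_of_mem_ball hb]
    · simp; ring
    · rw [circleIntegrable_sub_inv_iff]
      right
      rw [abs_of_pos hR]
      intro h
      exact hne b h b hb (sub_self b)
    · exact (continuousOn_logDeriv_sphere hE (sphere_subset_closedBall.trans hRE) hFd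
        hF0).circleIntegrable hR.le

/-- On the circle `g / h` stays in the unit disc around `1`, hence in the slit plane, so `log (g /
h)` is a single-valued primitive of the integrand. -/
theorem circleIntegral_logDeriv_sub_eq_zero {E : Set ℂ} (hE : IsOpen E) {R : ℝ} (hR : 0 < R)
    (hRE : sphere 0 R ⊆ E) {g h : ℂ → ℂ} (hg : DifferentiableOn ℂ g E)
    (hh : DifferentiableOn ℂ h E) (hgh : ∀ z ∈ sphere (0 : ℂ) R, ‖g z - h z‖ < ‖h z‖) :
    (∮ z in C(0, R), (logDeriv g z - logDeriv h z)) = 0 := by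
  apply circleIntegral.integral_eq_zero_of_hasDerivWithinAt (f := fun z => Complex.log (g z / h z))
    hR.le
  intro z hz
  have hzE := hE.mem_nhds (hRE hz)
  have hlt := hgh z hz
  have hh0 : h z ≠ 0 := fun h0 => by
    rw [h0, norm_zero] at hlt; exact absurd hlt (not_lt.2 (norm_nonneg _))
  have hg0 : g z ≠ 0 := fun h0 => by
    rw [h0, zero_sub, norm_neg] at hlt; exact lt_irrefl _ hlt
  have hslit : g z / h z ∈ slitPlane := by
    have h1 : ‖g z / h z - 1‖ < 1 := by
      rw [div_sub_one hh0, norm_div, div_lt_one (norm_pos_iff.2 hh0)]; exact hlt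
    have := mem_slitPlane_of_norm_lt_one h1
    simpa using this
  have dg := ((hg z (hRE hz)).differentiableAt hzE).hasDerivAt
  have dh := ((hh z (hRE hz)).differentiableAt hzE).hasDerivAt
  have := ((dg.div dh hh0).clog hslit).hasDerivWithinAt (s := sphere 0 R)
  refine this.congr_deriv ?_
  rw [show logDeriv g z = deriv g z / g z from rfl, show logDeriv h z = deriv h z / h z from rfl,
    show (g / h) z = g z / h z from rfl]
  field_simp

/-- **Rouché's theorem** for a disc around the origin, in terms of the zeros of two functions. -/
theorem card_zeros_eq_of_norm_sub_lt {E : Set ℂ} (hE : IsOpen E) {R : ℝ} (hR : 0 < R)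
    (hRE : closedBall 0 R ⊆ E) {v u : ℂ → ℂ} (hv : DifferentiableOn ℂ v E)
    (hu : DifferentiableOn ℂ u E)
    (hv0 : ∀ z ∈ closedBall (0 : ℂ) R, v z ≠ 0) (hu0 : ∀ z ∈ closedBall (0 : ℂ) R, u z ≠ 0)
    {Y Z : Multiset ℂ} (hY : ∀ z ∈ Y, z ∈ ball (0 : ℂ) R) (hZ : ∀ z ∈ Z, z ∈ ball (0 : ℂ) R)
    (hlt : ∀ z ∈ sphere (0 : ℂ) R,
      ‖v z * (Y.map (fun ζ => z - ζ)).prod - u z * (Z.map (fun ζ => z - ζ)).prod‖ <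
        ‖u z * (Z.map (fun ζ => z - ζ)).prod‖) :
    Multiset.card Y = Multiset.card Z := by
  have hdiff : ∀ {v : ℂ → ℂ}, DifferentiableOn ℂ v E → ∀ Z : Multiset ℂ,
      DifferentiableOn ℂ (fun w => v w * (Z.map (fun ζ => w - ζ)).prod) E := fun hv Z z hz =>
    (hv z hz).mul (analyticOrderAt_multiset_prod Z z).1.differentiableAt.differentiableWithinAt
  have hsE := (sphere_subset_closedBall (x := (0 : ℂ)) (ε := R)).trans hRE
  have h0 := circleIntegral_logDeriv_sub_eq_zero hE hR hsE (hdiff hv Y) (hdiff hu Z) hlt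
  have hne1 : ∀ z ∈ sphere (0 : ℂ) R, u z * (Z.map (fun ζ => z - ζ)).prod ≠ 0 := fun z hz h => by
    have := hlt z hz
    rw [h, norm_zero] at this
    exact absurd this (not_lt.2 (norm_nonneg _))
  have hne2 : ∀ z ∈ sphere (0 : ℂ) R, v z * (Y.map (fun ζ => z - ζ)).prod ≠ 0 := fun z hz h => by
    have := hlt z hz
    rw [h, zero_sub, norm_neg] at this
    exact lt_irrefl _ this
  rw [circleIntegral.integral_sub
    ((continuousOn_logDeriv_sphere hE hsE (hdiff hv Y) hne2).circleIntegrable hR.le)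
    ((continuousOn_logDeriv_sphere hE hsE (hdiff hu Z) hne1).circleIntegrable hR.le),
    circleIntegral_logDeriv_mul_prod hE hR hRE hv hv0 Y hY,
    circleIntegral_logDeriv_mul_prod hE hR hRE hu hu0 Z hZ, sub_eq_zero] at h0
  have := mul_left_cancel₀ Complex.two_pi_I_ne_zero h0
  exact_mod_cast this

/-- A small perturbation of a polynomial with all zeros in a disc has as many zeros in the closed
disc as the polynomial. -/
theorem hasExactlyZeros_of_norm_sub_lt {E : Set ℂ} (hE : IsOpen E) {R : ℝ} (hR : 0 < R)
    (hRE : closedBall 0 R ⊆ E) {g : ℂ → ℂ} (hg : DifferentiableOn ℂ g E) {c : ℂ} (hc : c ≠ 0)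
    {Z : Multiset ℂ} (hZ : ∀ z ∈ Z, z ∈ ball (0 : ℂ) R)
    (hlt : ∀ z ∈ sphere (0 : ℂ) R, ‖g z - c * (Z.map (fun ζ => z - ζ)).prod‖ <
      ‖c * (Z.map (fun ζ => z - ζ)).prod‖) :
    HasExactlyZeros g (closedBall 0 R) (Multiset.card Z) := by
  have hg0 : ∀ z ∈ sphere (0 : ℂ) R, g z ≠ 0 := fun z hz h => by
    have := hlt z hz
    rw [h, zero_sub, norm_neg] at this
    exact lt_irrefl _ this
  obtain ⟨Y, v, hY, hv, hgv, hv0⟩ := exists_zeros_multiset hE hR hRE hg hg0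
  refine ⟨Y, ?_, fun z hz => ball_subset_closedBall (hY z hz), fun z hz => ?_⟩
  · refine card_zeros_eq_of_norm_sub_lt hE hR hRE (u := fun _ => c) hv
      (differentiableOn_const c) hv0 (fun _ _ => hc) hY hZ fun z hz => ?_
    rw [← hgv z (hRE (sphere_subset_closedBall hz))]
    exact hlt z hz
  · have hva : AnalyticAt ℂ v z := hv.analyticAt (hE.mem_nhds (hRE hz))
    have hp := analyticOrderAt_multiset_prod Y z
    have h2 : analyticOrderAt g z = analyticOrderAt v z + Y.count z := by
      rw [← hp.2, ← analyticOrderAt_mul hva hp.1]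
      apply analyticOrderAt_congr
      filter_upwards [hE.mem_nhds (hRE hz)] with y hy using hgv y hy
    rw [h2, hva.analyticOrderAt_eq_zero.2 (hv0 z hz), zero_add]

end

/-! ### Chebyshev constants and the location of zeros. -/

theorem exists_fin_map_eq_multiset {k : ℕ} (Z : Multiset ℂ) (hZ : Multiset.card Z = k) :
    ∃ ζ : Fin k → ℂ, (Finset.univ.val.map ζ) = Z := by
  induction Z using Quotient.inductionOn with
  | h l =>
    have hl : l.length = k := by simpa using hZ
    subst hl
    refine ⟨l.get, ?_⟩
    simp

theorem bddAbove_range_nodal {K : Set ℂ} (hK : IsCompact K) {k : ℕ} (ζ : Fin k → ℂ) :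
    BddAbove (Set.range fun z : K => ∏ j, ‖(z : ℂ) - ζ j‖) := by
  have := hK.bddAbove_image (f := fun z : ℂ => ∏ j, ‖z - ζ j‖) (by fun_prop)
  rwa [Set.image_eq_range] at this

theorem chebyshevConst_le {K : Set ℂ} (hK : K.Nonempty) {k : ℕ} (ζ : Fin k → ℂ) {C : ℝ}
    (h : ∀ z ∈ K, ∏ j, ‖z - ζ j‖ ≤ C) : chebyshevConst K k ≤ C := by
  have : Nonempty K := hK.to_subtype
  refine (ciInf_le ⟨0, ?_⟩ ζ).trans (ciSup_le fun z => h z z.2)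
  rintro _ ⟨ζ, rfl⟩
  exact Real.iSup_nonneg fun z => Finset.prod_nonneg fun _ _ => norm_nonneg _

theorem exists_nodal_lt_of_chebyshevConst_lt {K : Set ℂ} (hK : IsCompact K) {k : ℕ} {C : ℝ}
    (h : chebyshevConst K k < C) : ∃ ζ : Fin k → ℂ, ∀ z ∈ K, ∏ j, ‖z - ζ j‖ < C := by
  obtain ⟨ζ, hζ⟩ := exists_lt_of_ciInf_lt h
  exact ⟨ζ, fun z hz => (le_ciSup (bddAbove_range_nodal hK ζ) ⟨z, hz⟩).trans_lt hζ⟩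

/-- Among more than `k` separated points of `K`, one is at distance at least half the separation
from all `k` nodes, by the pigeonhole principle. This bounds every nodal polynomial below by the
same constant. -/
theorem chebyshevConst_pos {K : Set ℂ} (hK : IsCompact K) (hKi : K.Infinite) (k : ℕ) :
    0 < chebyshevConst K k := by
  -- The pigeonhole principle needs `k + 1` points. One more makes `T` nontrivial, hence its
  -- separation positive, also for `k = 0`.
  obtain ⟨T, hTK, hT⟩ := hKi.exists_subset_card_eq (k + 2)
  have hnt : (T : Set ℂ).Nontrivial := by
    have : 1 < T.card := by omega
    simpa using Finset.one_lt_card_iff_nontrivial.1 this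
  have hδ : 0 < (T : Set ℂ).infsep := (T.finite_toSet.infsep_pos_iff_nontrivial).2 hnt
  set δ := (T : Set ℂ).infsep
  refine lt_of_lt_of_le (pow_pos (half_pos hδ) k) (le_ciInf fun ζ => ?_)
  have : ∃ w ∈ T, ∀ j, δ / 2 ≤ ‖w - ζ j‖ := by
    by_contra! hcon
    have : Nonempty (Fin k) := by
      obtain ⟨w, hw⟩ := hnt.nonempty
      exact ⟨(hcon w hw).choose⟩
    choose! i hi using hcon
    obtain ⟨x, hx, y, hy, hxy, he⟩ := Finset.exists_ne_map_eq_of_card_lt_of_maps_to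
      (s := T) (t := Finset.univ) (f := i) (by simp [hT]) (fun _ _ => by simp)
    have h1 : δ ≤ dist x y := (hnt.le_infsep_iff).1 le_rfl x hx y hy hxy
    have h2 := hi x hx
    have h3 := hi y hy
    rw [← he] at h3
    have h4 := dist_triangle_right x y (ζ (i x))
    rw [dist_eq_norm, dist_eq_norm] at h4
    rw [dist_eq_norm] at h1 h4
    linarith
  obtain ⟨w, hw, hwj⟩ := this
  refine le_trans ?_ (le_ciSup (bddAbove_range_nodal hK ζ) ⟨w, hTK hw⟩)
  calc (δ / 2) ^ k = ∏ _j : Fin k, (δ / 2) := by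
        simp only [Finset.prod_const, Finset.card_univ, Fintype.card_fin]
    _ ≤ _ := Finset.prod_le_prod (fun _ _ => (half_pos hδ).le) fun j _ => hwj j

/-- If a monic polynomial of degree `k + 1` is bounded by `C` on `K`, its zeros have distance at most
`C / t_k` from a disc around the origin that contains `K`. -/
theorem norm_root_le_of_nodal_le {K : Set ℂ} (hK : IsCompact K) (hKi : K.Infinite) {R C : ℝ}
    (hR : ∀ z ∈ K, ‖z‖ ≤ R) {k : ℕ} {Z : Multiset ℂ} (hZ : Multiset.card Z = k + 1)
    (hC : ∀ z ∈ K, ‖(Z.map (fun ζ => z - ζ)).prod‖ ≤ C) {ζ : ℂ} (hζ : ζ ∈ Z) :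
    ‖ζ‖ ≤ R + C / chebyshevConst K k := by
  have ht := chebyshevConst_pos hK hKi k
  obtain ⟨Y, rfl⟩ := Multiset.exists_cons_of_mem hζ
  obtain ⟨y, hy⟩ := exists_fin_map_eq_multiset Y (by simpa using hZ : Multiset.card Y = k)
  obtain ⟨z₀, hz₀⟩ := hKi.nonempty
  have hC0 : 0 ≤ C := (norm_nonneg _).trans (hC z₀ hz₀)
  by_contra! hlt
  have hd : C / chebyshevConst K k < ‖ζ‖ - R := by linarith
  have hd0 : 0 < ‖ζ‖ - R := (div_nonneg hC0 ht.le).trans_lt hd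
  -- On `K` the factor `z - ζ` has modulus at least `‖ζ‖ - R`. Dividing it out leaves a monic
  -- polynomial of degree `k`, and the resulting bound contradicts `hd`.
  have : chebyshevConst K k ≤ C / (‖ζ‖ - R) := by
    refine chebyshevConst_le hKi.nonempty y fun z hz => ?_
    rw [le_div_iff₀ hd0]
    have h1 := hC z hz
    rw [Multiset.map_cons, Multiset.prod_cons, norm_mul, ← hy, Multiset.map_map] at h1
    have h2 : ‖(Multiset.map ((fun ζ => z - ζ) ∘ y) Finset.univ.val).prod‖ = ∏ j, ‖z - y j‖ := by
      rw [← norm_prod]; rfl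
    rw [h2] at h1
    have h3 : ‖ζ‖ - R ≤ ‖z - ζ‖ := by
      have := norm_sub_norm_le ζ z
      rw [norm_sub_rev] at this
      linarith [hR z hz]
    have h4 : 0 ≤ ∏ j, ‖z - y j‖ := Finset.prod_nonneg fun _ _ => norm_nonneg _
    nlinarith
  rw [le_div_iff₀ hd0] at this
  rw [div_lt_iff₀ ht] at hd
  linarith

theorem infinite_of_preperfect {K : Set ℂ} (hne : K.Nonempty) (hK : Preperfect K) :
    K.Infinite := by
  obtain ⟨x, hx⟩ := hne
  intro hfin
  have := hK x hx
  rw [accPt_iff_frequently_nhdsNE] at this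
  have h2 : (K \ {x}).Finite := hfin.subset Set.sdiff_subset
  have h3 : ∀ᶠ y in 𝓝[≠] x, y ∉ K := by
    have : (K \ {x})ᶜ ∈ 𝓝 x := h2.isClosed.isOpen_compl.mem_nhds (by simp)
    filter_upwards [mem_nhdsWithin_of_mem_nhds this, self_mem_nhdsWithin] with y h1 h2 h3
    exact h1 ⟨h3, h2⟩
  exact this h3

/-! ### The linear map `(p, q) ↦ pQ - Pq`: range and kernel. -/

open Polynomial in
-- A Bézout identity solves the equation without degree bounds. Reducing modulo whichever of `P`,
-- `Q` has full degree bounds one unknown, and comparing degrees in the equation bounds the other.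
theorem exists_mul_sub_mul_eq {P Q : Polynomial ℂ} (hPQ : IsCoprime P Q) {m n : ℕ} (hQ0 : Q ≠ 0)
    (hP : P.natDegree ≤ m) (hQ : Q.natDegree ≤ n)
    (hdeg : Q.natDegree = n ∨ P ≠ 0 ∧ P.natDegree = m) {s : Polynomial ℂ}
    (hs : s.natDegree ≤ m + n) :
    ∃ u v : Polynomial ℂ, u.natDegree ≤ m ∧ v.natDegree ≤ n ∧ u * Q - P * v = s := by
  obtain ⟨b, c, hbc⟩ := hPQ
  rcases hdeg with h | ⟨hP0, h⟩
  · set v₀ := -s * b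
    set v := v₀ % Q
    set u := s * c - P * (v₀ / Q)
    have hv : v.natDegree ≤ n := by
      rw [← h]; exact natDegree_le_natDegree (degree_mod_lt _ hQ0).le
    have he : u * Q - P * v = s := by
      have h1 : Q * (v₀ / Q) + v = v₀ := EuclideanDomain.div_add_mod v₀ Q
      calc u * Q - P * v = s * c * Q - P * (Q * (v₀ / Q) + v) := by simp only [u]; ring
        _ = s * (b * P + c * Q) := by rw [h1]; simp only [v₀]; ring
        _ = s := by rw [hbc, mul_one]
    refine ⟨u, v, ?_, hv, he⟩
    by_cases hu : u = 0
    · simp [hu]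
    · have h1 : (u * Q).natDegree ≤ m + n := by
        rw [show u * Q = s + P * v by rw [← he]; ring]
        exact natDegree_add_le_of_degree_le hs (natDegree_mul_le.trans (add_le_add hP hv))
      rw [natDegree_mul hu hQ0] at h1
      omega
  · set u₀ := s * c
    set u := u₀ % P
    set v := -s * b - Q * (u₀ / P)
    have hu : u.natDegree ≤ m := by
      rw [← h]; exact natDegree_le_natDegree (degree_mod_lt _ hP0).le
    have he : u * Q - P * v = s := by
      have h1 : P * (u₀ / P) + u = u₀ := EuclideanDomain.div_add_mod u₀ P
      have h2 : u = u₀ - P * (u₀ / P) := by rw [eq_sub_iff_add_eq', h1]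
      calc u * Q - P * v = s * (b * P + c * Q) := by rw [h2]; simp only [u₀, v]; ring
        _ = s := by rw [hbc, mul_one]
    refine ⟨u, v, hu, ?_, he⟩
    by_cases hv : v = 0
    · simp [hv]
    · have h1 : (P * v).natDegree ≤ m + n := by
        rw [show P * v = u * Q - s by rw [← he]; ring]
        exact (natDegree_sub_le _ _).trans
          (max_le (natDegree_mul_le.trans (add_le_add hu hQ)) hs)
      rw [natDegree_mul hP0 hv] at h1
      omega

open Polynomial in
-- By coprimality `(u, v)` is a polynomial multiple of `(P, Q)`, and the full degree of `P` or `Q`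
-- leaves room only for a constant multiplier.
theorem exists_eq_C_mul_of_mul_eq_mul {P Q : Polynomial ℂ} (hPQ : IsCoprime P Q) {m n : ℕ}
    (hQ0 : Q ≠ 0) (hdeg : Q.natDegree = n ∨ P ≠ 0 ∧ P.natDegree = m) {u v : Polynomial ℂ}
    (hu : u.natDegree ≤ m) (hv : v.natDegree ≤ n) (h : u * Q = P * v) :
    ∃ c : ℂ, u = C c * P ∧ v = C c * Q := by
  obtain ⟨w, rfl⟩ : Q ∣ v := hPQ.symm.dvd_of_dvd_mul_left ⟨u, by rw [← h]; ring⟩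
  have hu' : u = P * w := mul_right_cancel₀ hQ0 (by rw [h]; ring)
  subst hu'
  have hw : w.natDegree = 0 := by
    by_cases hw0 : w = 0
    · simp [hw0]
    rcases hdeg with h | ⟨hP0, h⟩
    · rw [natDegree_mul hQ0 hw0] at hv; omega
    · rw [natDegree_mul hP0 hw0] at hu; omega
  obtain ⟨c, rfl⟩ := natDegree_eq_zero.1 hw
  exact ⟨c, mul_comm _ _, mul_comm _ _⟩

/-! ### Values, poles and reduced form of rational functions. -/

theorem degreeAtMost_natCast {k : ℕ} {p : Polynomial ℂ} :
    DegreeAtMost k p ↔ p.natDegree ≤ k := by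
  by_cases h : p = 0
  · simp [DegreeAtMost, h]
  · simp [DegreeAtMost, h]

theorem value_eq_num_div_denom (r : RatFunc ℂ) (z : ℂ) :
    value r z = r.num.eval z / r.denom.eval z := rfl

theorem value_of_eq_div {r : RatFunc ℂ} {p q : Polynomial ℂ}
    (hr : r = algebraMap (Polynomial ℂ) (RatFunc ℂ) p / algebraMap (Polynomial ℂ) (RatFunc ℂ) q)
    {z : ℂ} (hz : q.eval z ≠ 0) : ¬ IsPole r z ∧ value r z = p.eval z / q.eval z := by
  have hq : q ≠ 0 := fun h => hz (by simp [h])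
  have hd : r.denom.eval z ≠ 0 := by
    intro h
    obtain ⟨g, hg⟩ := (RatFunc.denom_dvd hq).2 ⟨p, hr⟩
    exact hz (by rw [hg, Polynomial.eval_mul, h, zero_mul])
  refine ⟨hd, ?_⟩
  have := (RatFunc.num_mul_eq_mul_denom_iff hq).2 hr
  rw [value_eq_num_div_denom, div_eq_div_iff hd hz, ← Polynomial.eval_mul, ← Polynomial.eval_mul,
    this]

theorem eval_eq_mul_value_of_not_isPole {r : RatFunc ℂ} {p q : Polynomial ℂ} (hq : q ≠ 0)
    (hr : r = algebraMap (Polynomial ℂ) (RatFunc ℂ) p / algebraMap (Polynomial ℂ) (RatFunc ℂ) q)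
    {z : ℂ} (hz : ¬ IsPole r z) : p.eval z = q.eval z * value r z := by
  have := congrArg (Polynomial.eval z) ((RatFunc.num_mul_eq_mul_denom_iff hq).2 hr)
  rw [Polynomial.eval_mul, Polynomial.eval_mul] at this
  have hd : r.denom.eval z ≠ 0 := hz
  rw [value_eq_num_div_denom]
  field_simp
  rw [← this]; ring

/-- Because `value` is `0` at poles, absence of a pole has to be extracted from the error estimate.
That estimate makes `value r` converge to `f 0`, so a zero of the denominator would force a common
zero of the numerator. -/
theorem denom_eval_zero_ne_zero {f : ℂ → ℂ} (hf : ContinuousAt f 0) {m n : ℕ} {r : RatFunc ℂ}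
    {a : ℂ} (ha : IsErrorCoeff f m n r a) : r.denom.eval 0 ≠ 0 := by
  intro h0
  have hnum : r.num.eval 0 ≠ 0 := by
    obtain ⟨b, c, hbc⟩ := r.isCoprime_num_denom
    intro h
    have := congrArg (Polynomial.eval 0) hbc
    simp [h, h0] at this
  have h1 : Filter.Tendsto (fun z : ℂ => value r z - f z - a * z ^ (m + n + 1)) (𝓝 0) (𝓝 0) := by
    refine ha.trans_tendsto ?_
    have : ContinuousAt (fun z : ℂ => z ^ (m + n + 2)) 0 := by fun_prop
    simpa [ContinuousAt] using this
  have h2 : Filter.Tendsto (fun z : ℂ => value r z) (𝓝 0) (𝓝 (f 0)) := by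
    have h3 : Filter.Tendsto (fun z : ℂ => a * z ^ (m + n + 1)) (𝓝 0) (𝓝 0) := by
      have : ContinuousAt (fun z : ℂ => a * z ^ (m + n + 1)) 0 := by fun_prop
      simpa [ContinuousAt] using this
    have := (h1.add h3).add hf.tendsto
    simpa using this
  have hden : Filter.Tendsto (fun z : ℂ => r.denom.eval z) (𝓝 0) (𝓝 0) := by
    have := r.denom.continuous.tendsto 0
    rwa [h0] at this
  have h4 : Filter.Tendsto (fun z : ℂ => value r z * r.denom.eval z) (𝓝[≠] 0) (𝓝 0) := by
    have := h2.mul hden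
    rw [mul_zero] at this
    exact this.mono_left nhdsWithin_le_nhds
  have h5 : Filter.Tendsto (fun z : ℂ => r.num.eval z) (𝓝[≠] 0) (𝓝 (r.num.eval 0)) :=
    (r.num.continuous.tendsto 0).mono_left nhdsWithin_le_nhds
  refine hnum (tendsto_nhds_unique (h5.congr' ?_) h4)
  have hfin : ({z | r.denom.IsRoot z} \ {0}).Finite :=
    (Polynomial.finite_setOfPred_isRoot r.denom_ne_zero).subset Set.sdiff_subset
  have : ({z | r.denom.IsRoot z} \ {0})ᶜ ∈ 𝓝 (0 : ℂ) :=
    hfin.isClosed.isOpen_compl.mem_nhds (by simp)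
  filter_upwards [mem_nhdsWithin_of_mem_nhds this, self_mem_nhdsWithin] with z hz hz0
  have : r.denom.eval z ≠ 0 := fun h => hz ⟨h, hz0⟩
  rw [value_eq_num_div_denom]
  field_simp

/-- The reduced representation of a non-degenerate rational function without a pole at the origin. -/
theorem exists_coprime_of_isNondegenerate {m n : ℕ} {r : RatFunc ℂ} (hr : IsNondegenerate m n r)
    (h0 : r.denom.eval 0 ≠ 0) : ∃ P Q : Polynomial ℂ, IsCoprime P Q ∧ P.natDegree ≤ m ∧
      Q.natDegree ≤ n ∧ Q.eval 0 = 1 ∧ (Q.natDegree = n ∨ P ≠ 0 ∧ P.natDegree = m) ∧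
      r = algebraMap (Polynomial ℂ) (RatFunc ℂ) P / algebraMap (Polynomial ℂ) (RatFunc ℂ) Q := by
  obtain ⟨⟨p, q, hp, hq, hq0, hpq⟩, hmax⟩ := hr
  rw [degreeAtMost_natCast] at hp hq
  have hden : r.denom.natDegree ≤ n :=
    (Polynomial.natDegree_le_of_dvd ((RatFunc.denom_dvd hq0).2 ⟨p, hpq⟩) hq0).trans hq
  have hnum : r.num.natDegree ≤ m := by
    by_cases hp0 : p = 0
    · simp [hpq, hp0]
    · exact (Polynomial.natDegree_le_of_dvd ((RatFunc.num_dvd hp0).2 ⟨q, hq0, hpq⟩) hp0).trans hp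
  set c := r.denom.eval 0
  have hu : IsUnit (Polynomial.C c⁻¹) := Polynomial.isUnit_C.2 (IsUnit.mk0 _ (inv_ne_zero h0))
  have hc : Polynomial.C c⁻¹ ≠ 0 := hu.ne_zero
  refine ⟨Polynomial.C c⁻¹ * r.num, Polynomial.C c⁻¹ * r.denom, ?_, ?_, ?_, ?_, ?_, ?_⟩
  · exact (isCoprime_mul_unit_left hu _ _).2 r.isCoprime_num_denom
  · rwa [Polynomial.natDegree_C_mul (inv_ne_zero h0)]
  · rwa [Polynomial.natDegree_C_mul (inv_ne_zero h0)]
  · rw [Polynomial.eval_mul, Polynomial.eval_C]; exact inv_mul_cancel₀ h0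
  · rw [Polynomial.natDegree_C_mul (inv_ne_zero h0), Polynomial.natDegree_C_mul (inv_ne_zero h0)]
    by_contra! hcon
    -- If neither degree is full, the defect is at least one. A zero numerator never has full
    -- degree, even for `m = 0`, hence the clause `P ≠ 0` in the disjunction.
    have h1 : r ∈ rationals ((m : ℤ) - (1 : ℕ)) (n - (1 : ℕ)) := by
      refine ⟨r.num, r.denom, fun hne => ?_, fun _ => ?_, r.denom_ne_zero,
        r.num_div_denom.symm⟩
      · have := hcon.2 (mul_ne_zero hc hne)
        omega
      · have := hcon.1
        omega
    exact one_ne_zero (hmax 1 h1)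
  · rw [map_mul, map_mul, mul_div_mul_left _ _ (RatFunc.algebraMap_ne_zero hc),
      RatFunc.num_div_denom]

/-! ### Rational functions near the Padé approximant and their error to first order. -/

open Polynomial in
/-- `P / Q` is a point of `R_{mn}` at which the map `(p, q) ↦ p Q - P q` is onto the polynomials of
degree at most `m + n`, with one-dimensional kernel; `(u k, v k)` are preimages of the monomials. -/
structure IsLocalFrame (m n : ℕ) (P Q : ℂ[X]) (u v : Fin (m + n + 1) → ℂ[X]) : Prop where
  natDegree_num : P.natDegree ≤ m
  natDegree_den : Q.natDegree ≤ n
  eval_zero : Q.eval 0 = 1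
  natDegree_u : ∀ k, (u k).natDegree ≤ m
  natDegree_v : ∀ k, (v k).natDegree ≤ n
  mul_sub_mul : ∀ k, u k * Q - P * v k = X ^ (k : ℕ)
  eq_of_mul_eq : ∀ p q : ℂ[X], p.natDegree ≤ m → q.natDegree ≤ n → p * Q = P * q →
    ∃ c : ℂ, p = C c * P ∧ q = C c * Q

theorem exists_isLocalFrame {P Q : Polynomial ℂ} (hPQ : IsCoprime P Q) {m n : ℕ}
    (hQ0 : Q.eval 0 = 1) (hP : P.natDegree ≤ m) (hQ : Q.natDegree ≤ n)
    (hdeg : Q.natDegree = n ∨ P ≠ 0 ∧ P.natDegree = m) :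
    ∃ u v : Fin (m + n + 1) → Polynomial ℂ, IsLocalFrame m n P Q u v := by
  have hQ' : Q ≠ 0 := by rintro rfl; simp at hQ0
  have h : ∀ k : Fin (m + n + 1), ∃ u v : Polynomial ℂ, u.natDegree ≤ m ∧ v.natDegree ≤ n ∧
      u * Q - P * v = Polynomial.X ^ (k : ℕ) := fun k =>
    exists_mul_sub_mul_eq hPQ hQ' hP hQ hdeg (by simp; omega)
  choose u v hu hv huv using h
  exact ⟨u, v, hP, hQ, hQ0, hu, hv, huv,
    fun p q hp hq => exists_eq_C_mul_of_mul_eq_mul hPQ hQ' hdeg hp hq⟩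

/-- The polynomial `P + ∑ c_k u_k`. -/
def perturb {N : ℕ} (P : Polynomial ℂ) (u : Fin N → Polynomial ℂ) (c : Fin N → ℂ) :
    Polynomial ℂ :=
  P + ∑ k, Polynomial.C (c k) * u k

/-- The coefficients of `a ε ^ N ∑ x_k (z / ε) ^ k`. -/
def scaledCoeff {N : ℕ} (a : ℂ) (ε : ℝ) (x : Fin N → ℂ) (k : Fin N) : ℂ :=
  a * (ε : ℂ) ^ (N - (k : ℕ)) * x k

/-- The rational function near `P / Q` whose difference to `P / Q` has the numerator
`a ε ^ N ∑ x_k (z / ε) ^ k`. -/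
def nearby {N : ℕ} (P Q : Polynomial ℂ) (u v : Fin N → Polynomial ℂ) (a : ℂ) (ε : ℝ)
    (x : Fin N → ℂ) : RatFunc ℂ :=
  algebraMap (Polynomial ℂ) (RatFunc ℂ) (perturb P u (scaledCoeff a ε x)) /
    algebraMap (Polynomial ℂ) (RatFunc ℂ) (perturb Q v (scaledCoeff a ε x))

theorem eval_perturb {N : ℕ} (P : Polynomial ℂ) (u : Fin N → Polynomial ℂ) (c : Fin N → ℂ)
    (z : ℂ) : (perturb P u c).eval z = P.eval z + ∑ k, c k * (u k).eval z := by
  simp [perturb, Polynomial.eval_finsetSum]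

theorem natDegree_perturb_le {N : ℕ} {P : Polynomial ℂ} {u : Fin N → Polynomial ℂ} {m : ℕ}
    (hP : P.natDegree ≤ m) (hu : ∀ k, (u k).natDegree ≤ m) (c : Fin N → ℂ) :
    (perturb P u c).natDegree ≤ m :=
  Polynomial.natDegree_add_le_of_degree_le hP
    (Polynomial.natDegree_sum_le_of_forall_le _ _ fun k _ =>
      (Polynomial.natDegree_C_mul_le _ _).trans (hu k))

theorem IsLocalFrame.isQuotient_nearby {m n : ℕ} {P Q : Polynomial ℂ}
    {u v : Fin (m + n + 1) → Polynomial ℂ} (h : IsLocalFrame m n P Q u v) {a : ℂ} {ε : ℝ}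
    {x : Fin (m + n + 1) → ℂ} (hq : perturb Q v (scaledCoeff a ε x) ≠ 0) :
    IsQuotient m n (nearby P Q u v a ε x) (perturb P u (scaledCoeff a ε x))
      (perturb Q v (scaledCoeff a ε x)) :=
  ⟨degreeAtMost_natCast.2 (natDegree_perturb_le h.natDegree_num h.natDegree_u _),
    degreeAtMost_natCast.2 (natDegree_perturb_le h.natDegree_den h.natDegree_v _), hq, rfl⟩

theorem IsLocalFrame.perturb_mul_sub {m n : ℕ} {P Q : Polynomial ℂ}
    {u v : Fin (m + n + 1) → Polynomial ℂ} (h : IsLocalFrame m n P Q u v)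
    (c : Fin (m + n + 1) → ℂ) :
    perturb P u c * Q - P * perturb Q v c = ∑ k, Polynomial.C (c k) * Polynomial.X ^ (k : ℕ) := by
  simp only [perturb, ← h.mul_sub_mul, mul_sub, Finset.sum_sub_distrib, add_mul, mul_add,
    Finset.sum_mul, Finset.mul_sum]
  have h1 : ∀ k, P * (Polynomial.C (c k) * v k) = Polynomial.C (c k) * (P * v k) :=
    fun k => by ring
  simp only [h1, mul_assoc]
  ring

theorem sum_scaledCoeff_mul_pow {N : ℕ} (a : ℂ) (ε : ℝ) (x : Fin N → ℂ) (w : ℂ) :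
    ∑ k, scaledCoeff a ε x k * ((ε : ℂ) * w) ^ (k : ℕ) =
      a * (ε : ℂ) ^ N * ∑ k, x k * w ^ (k : ℕ) := by
  rw [Finset.mul_sum]
  refine Finset.sum_congr rfl fun k _ => ?_
  have : (ε : ℂ) ^ N = (ε : ℂ) ^ (N - (k : ℕ)) * (ε : ℂ) ^ (k : ℕ) := by
    rw [← pow_add, Nat.sub_add_cancel k.2.le]
  rw [this, scaledCoeff, mul_pow]
  ring

theorem continuous_eval_perturb {N : ℕ} (P : Polynomial ℂ) (u : Fin N → Polynomial ℂ) (a : ℂ) :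
    Continuous fun y : ℝ × (Fin N → ℂ) × ℂ =>
      (perturb P u (scaledCoeff a y.1 y.2.1)).eval ((y.1 : ℂ) * y.2.2) := by
  simp only [eval_perturb, scaledCoeff]
  have hz : Continuous fun y : ℝ × (Fin N → ℂ) × ℂ => (y.1 : ℂ) * y.2.2 := by fun_prop
  have hP : ∀ p : Polynomial ℂ,
      Continuous fun y : ℝ × (Fin N → ℂ) × ℂ => p.eval ((y.1 : ℂ) * y.2.2) :=
    fun p => p.continuous.comp hz
  refine (hP P).add (continuous_finsetSum _ fun k _ => ?_)
  exact Continuous.mul (by fun_prop) (hP (u k))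

open Metric in
/-- The error of the rational functions near the Padé approximant on small discs, to first order. -/
theorem IsLocalFrame.eventually_norm_nearby_sub_le {m n : ℕ} {P Q : Polynomial ℂ}
    {u v : Fin (m + n + 1) → Polynomial ℂ} (h : IsLocalFrame m n P Q u v) {f : ℂ → ℂ} {a : ℂ}
    (hf : (fun z : ℂ => P.eval z / Q.eval z - f z - a * z ^ (m + n + 1)) =o[𝓝 0]
      fun z : ℂ => z ^ (m + n + 1)) (B ρ : ℝ) {η : ℝ} (hη : 0 < η) :
    ∀ᶠ ε : ℝ in 𝓝[>] 0, ∀ x ∈ closedBall (0 : Fin (m + n + 1) → ℂ) B,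
      ∀ w ∈ closedBall (0 : ℂ) ρ,
        (perturb Q v (scaledCoeff a ε x)).eval ((ε : ℂ) * w) ≠ 0 ∧
        ‖(perturb P u (scaledCoeff a ε x)).eval ((ε : ℂ) * w) /
            (perturb Q v (scaledCoeff a ε x)).eval ((ε : ℂ) * w) - f ((ε : ℂ) * w) -
          a * (ε : ℂ) ^ (m + n + 1) * (w ^ (m + n + 1) + ∑ k, x k * w ^ (k : ℕ))‖
            ≤ η * ε ^ (m + n + 1) := by
  set G : ℝ × (Fin (m + n + 1) → ℂ) × ℂ → ℂ := fun y =>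
    (perturb Q v (scaledCoeff a y.1 y.2.1)).eval ((y.1 : ℂ) * y.2.2) *
      Q.eval ((y.1 : ℂ) * y.2.2) with hG
  set H : ℝ × (Fin (m + n + 1) → ℂ) × ℂ → ℂ := fun y =>
    a * (∑ k, y.2.1 k * y.2.2 ^ (k : ℕ)) * ((G y)⁻¹ - 1) with hH
  have hz : Continuous fun y : ℝ × (Fin (m + n + 1) → ℂ) × ℂ => (y.1 : ℂ) * y.2.2 := by fun_prop
  have hGc : Continuous G := (continuous_eval_perturb Q v a).mul (Q.continuous.comp hz)
  -- Every scaled coefficient carries a power `ε ^ (N - k)` with `N - k ≥ 1`, so the perturbation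
  -- disappears at `ε = 0` and `G` reduces to `Q(0)²`.
  have hG0 : ∀ y, G (0, y) = 1 := by
    intro y
    have : ∀ k : Fin (m + n + 1), m + n + 1 - (k : ℕ) ≠ 0 := fun k => by have := k.2; omega
    simp [hG, eval_perturb, scaledCoeff, h.eval_zero, this]
  -- Half of `η` is reserved for the Padé error and half for `H`. The number `|ρ| + 1` bounds `‖w‖`
  -- and is positive whatever the sign of `ρ`.
  have hη' : 0 < η / (2 * (|ρ| + 1) ^ (m + n + 1)) := by positivity
  have hfe := hf.def hη'
  have key : ∀ᶠ ε : ℝ in 𝓝 0, ∀ y ∈ closedBall (0 : Fin (m + n + 1) → ℂ) B ×ˢ closedBall (0 : ℂ) ρ,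
      G (ε, y) ≠ 0 ∧ ‖H (ε, y)‖ < η / 2 ∧
        ‖P.eval ((ε : ℂ) * y.2) / Q.eval ((ε : ℂ) * y.2) - f ((ε : ℂ) * y.2) -
          a * ((ε : ℂ) * y.2) ^ (m + n + 1)‖ ≤ η / (2 * (|ρ| + 1) ^ (m + n + 1)) * ‖((ε : ℂ) * y.2) ^ (m + n + 1)‖ := by
    refine ((isCompact_closedBall _ _).prod
      (isCompact_closedBall _ _)).eventually_forall_of_forall_eventually fun y _ => ?_
    have hGy : Filter.Tendsto G (𝓝 (0, y)) (𝓝 1) := by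
      rw [← hG0 y]; exact hGc.tendsto _
    have hHy : Filter.Tendsto H (𝓝 (0, y)) (𝓝 0) := by
      have h1 : Filter.Tendsto (fun y : ℝ × (Fin (m + n + 1) → ℂ) × ℂ =>
          a * (∑ k, y.2.1 k * y.2.2 ^ (k : ℕ))) (𝓝 (0, y))
          (𝓝 (a * (∑ k, y.1 k * y.2 ^ (k : ℕ)))) := by
        have : Continuous (fun y : ℝ × (Fin (m + n + 1) → ℂ) × ℂ =>
          a * (∑ k, y.2.1 k * y.2.2 ^ (k : ℕ))) := by fun_prop
        exact this.tendsto _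
      have h2 := h1.mul ((hGy.inv₀ one_ne_zero).sub_const 1)
      simpa using h2
    have hzy : Filter.Tendsto (fun y : ℝ × (Fin (m + n + 1) → ℂ) × ℂ => (y.1 : ℂ) * y.2.2) (𝓝 (0, y))
        (𝓝 0) := by
      have := hz.tendsto (0, y)
      simpa using this
    filter_upwards [hGy.eventually_ne one_ne_zero,
      hHy.norm.eventually_lt_const (show ‖(0 : ℂ)‖ < η / 2 by rw [norm_zero]; exact half_pos hη), hzy.eventually hfe]
      with y h1 h2 h3 using ⟨h1, h2, h3⟩
  filter_upwards [nhdsWithin_le_nhds key, self_mem_nhdsWithin] with ε hε hε0 x hx w hw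
  obtain ⟨hG1, hH1, hf1⟩ := hε (x, w) ⟨hx, hw⟩
  have hε0 : 0 < ε := hε0
  simp only [hG, hH] at hG1 hH1 hf1
  have hq := left_ne_zero_of_mul hG1
  have hQ := right_ne_zero_of_mul hG1
  refine ⟨hq, ?_⟩
  have hid := congrArg (Polynomial.eval ((ε : ℂ) * w)) (h.perturb_mul_sub (scaledCoeff a ε x))
  simp only [Polynomial.eval_sub, Polynomial.eval_mul, Polynomial.eval_finsetSum,
    Polynomial.eval_C, Polynomial.eval_pow, Polynomial.eval_X] at hid
  rw [sum_scaledCoeff_mul_pow] at hid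
  set p₁ := (perturb P u (scaledCoeff a ε x)).eval ((ε : ℂ) * w)
  set q₁ := (perturb Q v (scaledCoeff a ε x)).eval ((ε : ℂ) * w)
  set S := ∑ k, x k * w ^ (k : ℕ)
  -- This follows from `p₁ / q₁ - P / Q = (p₁ Q - P q₁) / (q₁ Q)`, whose numerator is `a ε^N S`.
  -- Replacing the denominator by `1` costs `ε^N H`.
  have hsplit : p₁ / q₁ - f ((ε : ℂ) * w) - a * (ε : ℂ) ^ (m + n + 1) * (w ^ (m + n + 1) + S) =
      (P.eval ((ε : ℂ) * w) / Q.eval ((ε : ℂ) * w) - f ((ε : ℂ) * w) - a * ((ε : ℂ) * w) ^ (m + n + 1)) +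
      (ε : ℂ) ^ (m + n + 1) * (a * S * ((q₁ * Q.eval ((ε : ℂ) * w))⁻¹ - 1)) := by
    have h1 : p₁ / q₁ = P.eval ((ε : ℂ) * w) / Q.eval ((ε : ℂ) * w) +
        a * (ε : ℂ) ^ (m + n + 1) * S * (q₁ * Q.eval ((ε : ℂ) * w))⁻¹ := by
      rw [← hid]; field_simp; ring
    rw [h1, mul_pow]; ring
  rw [hsplit]
  refine (norm_add_le _ _).trans ?_
  have e1 : ‖(ε : ℂ) ^ (m + n + 1) * (a * S * ((q₁ * Q.eval ((ε : ℂ) * w))⁻¹ - 1))‖ ≤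
      ε ^ (m + n + 1) * (η / 2) := by
    rw [norm_mul, norm_pow, Complex.norm_real, Real.norm_of_nonneg hε0.le]
    exact mul_le_mul_of_nonneg_left hH1.le (by positivity)
  have e2 : η / (2 * (|ρ| + 1) ^ (m + n + 1)) * ‖((ε : ℂ) * w) ^ (m + n + 1)‖ ≤ ε ^ (m + n + 1) * (η / 2) := by
    rw [norm_pow, norm_mul, Complex.norm_real, Real.norm_of_nonneg hε0.le, mul_pow]
    have hw' : ‖w‖ ≤ |ρ| + 1 := by
      have : ‖w‖ ≤ ρ := by simpa using hw
      linarith [le_abs_self ρ]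
    calc η / (2 * (|ρ| + 1) ^ (m + n + 1)) * (ε ^ (m + n + 1) * ‖w‖ ^ (m + n + 1))
        ≤ η / (2 * (|ρ| + 1) ^ (m + n + 1)) * (ε ^ (m + n + 1) * (|ρ| + 1) ^ (m + n + 1)) := by gcongr
      _ = ε ^ (m + n + 1) * (η / 2) := by field_simp
  linarith [hf1.trans e2]

/-! ### Competitors with small error lie in a compact part of the family. -/

theorem uniformError_le_ofReal_iff {L : Set ℂ} {f : ℂ → ℂ} {r : RatFunc ℂ} {T : ℝ} (hT : 0 ≤ T) :
    uniformError L f r ≤ ENNReal.ofReal T ↔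
      ∀ z ∈ L, ¬ IsPole r z ∧ ‖value r z - f z‖ ≤ T := by
  simp only [uniformError, iSup_le_iff]
  refine forall₂_congr fun z _ => ?_
  by_cases h : IsPole r z
  · simp [h]
  · simp only [h, if_false, not_false_iff, true_and]
    rw [← ofReal_norm, ENNReal.ofReal_le_ofReal_iff hT]

/-- Evaluation at `N` distinct points of `K` is an invertible Vandermonde map, hence bounded below.
-/
theorem exists_norm_le_of_norm_sum_mul_pow_le {K : Set ℂ} (hK : K.Infinite) (N : ℕ) :
    ∃ A : ℝ, 0 < A ∧ ∀ (y : Fin N → ℂ) (T : ℝ),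
      (∀ w ∈ K, ‖∑ k, y k * w ^ (k : ℕ)‖ ≤ T) → ‖y‖ ≤ A * T := by
  have : Infinite K := hK.to_subtype
  let w : Fin N ↪ K := (Fin.valEmbedding).trans (Infinite.natEmbedding K)
  let W : Fin N → ℂ := fun i => w i
  have hW : Function.Injective W := Subtype.val_injective.comp w.injective
  have hdet : (Matrix.vandermonde W).det ≠ 0 := Matrix.det_vandermonde_ne_zero_iff.2 hW
  obtain ⟨A, hA, hA'⟩ := (Matrix.vandermonde W).mulVecLin.exists_antilipschitzWith (by
    rw [LinearMap.ker_eq_bot']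
    intro y hy
    exact Matrix.eq_zero_of_mulVec_eq_zero hdet (by simpa using hy))
  refine ⟨A, hA, fun y T hT => ?_⟩
  obtain ⟨w₀, hw₀⟩ := hK.nonempty
  have hT0 : 0 ≤ T := (norm_nonneg _).trans (hT w₀ hw₀)
  have h1 : ‖y‖ ≤ A * ‖(Matrix.vandermonde W).mulVecLin y‖ :=
    ZeroHomClass.bound_of_antilipschitz _ hA' y
  refine h1.trans (mul_le_mul_of_nonneg_left ?_ A.2)
  rw [pi_norm_le_iff_of_nonneg hT0]
  intro i
  have := hT (W i) (w i).2
  have e : (Matrix.vandermonde W).mulVecLin y i = ∑ k, y k * W i ^ (k : ℕ) := by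
    simp [Matrix.mulVec, dotProduct, Matrix.vandermonde_apply, mul_comm]
  rwa [e]

/-- Every pair `(p, q)` is a combination of `(P, Q)` and of the `(u k, v k)`. -/
theorem IsLocalFrame.exists_eq_perturb {m n : ℕ} {P Q : Polynomial ℂ}
    {u v : Fin (m + n + 1) → Polynomial ℂ} (h : IsLocalFrame m n P Q u v) {p q : Polynomial ℂ}
    (hp : p.natDegree ≤ m) (hq : q.natDegree ≤ n) :
    ∃ (c : ℂ) (s : Fin (m + n + 1) → ℂ), p = perturb (Polynomial.C c * P) u s ∧
      q = perturb (Polynomial.C c * Q) v s ∧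
      p * Q - P * q = ∑ k, Polynomial.C (s k) * Polynomial.X ^ (k : ℕ) := by
  have hdeg : (p * Q - P * q).natDegree < m + n + 1 := by
    refine Nat.lt_succ_of_le ((Polynomial.natDegree_sub_le _ _).trans (max_le ?_ ?_))
    · exact Polynomial.natDegree_mul_le.trans (add_le_add hp h.natDegree_den)
    · exact Polynomial.natDegree_mul_le.trans (add_le_add h.natDegree_num hq)
  set s : Fin (m + n + 1) → ℂ := fun k => (p * Q - P * q).coeff k with hs
  have hsum : p * Q - P * q = ∑ k, Polynomial.C (s k) * Polynomial.X ^ (k : ℕ) := by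
    rw [Fin.sum_univ_eq_sum_range
      (fun k => Polynomial.C ((p * Q - P * q).coeff k) * Polynomial.X ^ k)]
    exact Polynomial.as_sum_range_C_mul_X_pow' _ hdeg
  have hu := natDegree_perturb_le (P := 0) (by simp) h.natDegree_u s
  have hv := natDegree_perturb_le (P := 0) (by simp) h.natDegree_v s
  have h0 := h.perturb_mul_sub s
  rw [← hsum] at h0
  have e1 : perturb P u s = P + perturb 0 u s := by simp [perturb]
  have e2 : perturb Q v s = Q + perturb 0 v s := by simp [perturb]
  rw [e1, e2] at h0
  -- The combination of the `(u k, v k)` with the coefficients of `pQ - Pq` has the same image as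
  -- `(p, q)`, so the difference lies in the kernel.
  obtain ⟨c, hc1, hc2⟩ := h.eq_of_mul_eq (p - perturb 0 u s) (q - perturb 0 v s)
    ((Polynomial.natDegree_sub_le _ _).trans (max_le hp hu))
    ((Polynomial.natDegree_sub_le _ _).trans (max_le hq hv)) (by linear_combination -h0)
  refine ⟨c, s, ?_, ?_, hsum⟩
  · rw [sub_eq_iff_eq_add] at hc1
    rw [hc1]; simp [perturb]
  · rw [sub_eq_iff_eq_add] at hc2
    rw [hc2]; simp [perturb]

/-- A rational function with an error of the order `ε ^ (m + n + 1)` on `ε K` is near the Padé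
approximant. -/
theorem IsLocalFrame.exists_eventually_eq_nearby {m n : ℕ} {P Q : Polynomial ℂ}
    {u v : Fin (m + n + 1) → Polynomial ℂ} (h : IsLocalFrame m n P Q u v) {f : ℂ → ℂ} {a : ℂ}
    (ha : a ≠ 0) (hf : (fun z : ℂ => P.eval z / Q.eval z - f z) =O[𝓝 0]
      fun z : ℂ => z ^ (m + n + 1)) {K : Set ℂ} (hKi : K.Infinite) (hKb : Bornology.IsBounded K)
    {M : ℝ} (hM : 0 ≤ M) :
    ∃ B : ℝ, ∀ᶠ ε : ℝ in 𝓝[>] 0, ∀ r ∈ rationals m n,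
      (∀ w ∈ K, ¬ IsPole r ((ε : ℂ) * w) ∧
        ‖value r ((ε : ℂ) * w) - f ((ε : ℂ) * w)‖ ≤ M * ε ^ (m + n + 1)) →
      ∃ x ∈ Metric.closedBall (0 : Fin (m + n + 1) → ℂ) B, r = nearby P Q u v a ε x := by
  obtain ⟨A, hA, hA'⟩ := exists_norm_le_of_norm_sum_mul_pow_le hKi (m + n + 1)
  obtain ⟨R, hR0, hR⟩ := hKb.exists_pos_norm_le
  obtain ⟨D₀, hD₀⟩ := hf.bound
  have hloc : ∀ p : Polynomial ℂ, ∀ᶠ z in 𝓝 (0 : ℂ), ‖p.eval z‖ ≤ ‖p.eval 0‖ + 1 := fun p =>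
    (p.continuous.norm.tendsto 0).eventually_le_const (by linarith)
  set D : ℝ := |D₀| + (∑ k, ‖(v k).eval 0‖) + 2 with hD
  have hsum0 : 0 ≤ ∑ k, ‖(v k).eval 0‖ := Finset.sum_nonneg fun _ _ => norm_nonneg _
  have hD0 : 0 < D := by have := abs_nonneg D₀; linarith
  have hQne : ∀ᶠ z in 𝓝 (0 : ℂ), Q.eval z ≠ 0 :=
    Q.continuous.continuousAt.eventually_ne (by rw [h.eval_zero]; exact one_ne_zero)
  have hall : ∀ᶠ z in 𝓝 (0 : ℂ), Q.eval z ≠ 0 ∧ ‖Q.eval z‖ ≤ D ∧ (∀ k, ‖(v k).eval z‖ ≤ D) ∧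
      ‖P.eval z / Q.eval z - f z‖ ≤ D * ‖z‖ ^ (m + n + 1) := by
    filter_upwards [hQne, hloc Q, Filter.eventually_all.2 fun k => hloc (v k), hD₀]
      with z h1 h2 h3 h4
    refine ⟨h1, ?_, fun k => ?_, ?_⟩
    · rw [h.eval_zero, norm_one] at h2
      linarith [abs_nonneg D₀]
    · have := Finset.single_le_sum (f := fun k => ‖(v k).eval 0‖) (fun _ _ => norm_nonneg _)
        (Finset.mem_univ k)
      linarith [abs_nonneg D₀, h3 k]
    · rw [norm_pow] at h4
      refine h4.trans (mul_le_mul_of_nonneg_right ?_ (by positivity))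
      linarith [le_abs_self D₀]
  obtain ⟨δ, hδ, hδ'⟩ := Metric.eventually_nhds_iff.1 hall
  set W : ℝ := A * (D * D * (M + D * R ^ (m + n + 1))) with hW
  have hW0 : 0 ≤ W := by positivity
  have hsm : ∀ c : ℝ, 0 < c → ∀ᶠ ε : ℝ in 𝓝[>] 0, ε < c := fun c hc =>
    nhdsWithin_le_nhds (gt_mem_nhds hc)
  refine ⟨2 * W / ‖a‖, ?_⟩
  filter_upwards [self_mem_nhdsWithin, hsm 1 one_pos, hsm (δ / R) (by positivity),
    hsm (1 / (2 * (W * (m + n + 1 : ℕ) + 1))) (by positivity)] with ε hε0 hε1 hε2 hε3 r hr hrK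
  have hε0 : 0 < ε := hε0
  have hεN : 0 < ε ^ (m + n + 1) := pow_pos hε0 _
  have hεc : (ε : ℂ) ≠ 0 := by exact_mod_cast hε0.ne'
  have hεn : ‖(ε : ℂ)‖ = ε := by rw [Complex.norm_real, Real.norm_of_nonneg hε0.le]
  obtain ⟨p, q, hp, hq, hq0, hpq⟩ := hr
  rw [degreeAtMost_natCast] at hp hq
  obtain ⟨c, s, hps, hqs, hs⟩ := h.exists_eq_perturb hp hq
  -- These are the coefficients of `pQ - Pq` in the variable `w = z / ε`, to which the Vandermonde
  -- bound on the fixed set `K` applies.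
  obtain ⟨y, hy⟩ : ∃ y : Fin (m + n + 1) → ℂ, y = fun k => s k * (ε : ℂ) ^ (k : ℕ) := ⟨_, rfl⟩
  have hsk : ∀ k, ε ^ (m + n + 1) * ‖s k‖ ≤ ε * ‖y‖ := by
    intro k
    have h1 : ‖s k‖ * ε ^ (k : ℕ) ≤ ‖y‖ := by
      have := norm_le_pi_norm y k
      rwa [show y k = s k * (ε : ℂ) ^ (k : ℕ) by rw [hy], norm_mul, norm_pow, hεn] at this
    have h2 : ε ^ (m + n + 1) = ε ^ (m + n + 1 - (k : ℕ)) * ε ^ (k : ℕ) := by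
      rw [← pow_add, Nat.sub_add_cancel k.2.le]
    have h3 : ε ^ (m + n + 1 - (k : ℕ)) ≤ ε :=
      pow_le_of_le_one hε0.le hε1.le (by have := k.2; omega)
    calc ε ^ (m + n + 1) * ‖s k‖ = ε ^ (m + n + 1 - (k : ℕ)) * (‖s k‖ * ε ^ (k : ℕ)) := by rw [h2]; ring
      _ ≤ ε * ‖y‖ := by gcongr
  -- On `εK` one has `pQ - Pq = qQ ((r - f) - (P/Q - f))`, where the bracket is `O(ε^N)` and `q` is
  -- bounded through `c` and `s`, hence through `c` and `y`.
  have hyb : ‖y‖ ≤ W * (ε ^ (m + n + 1) * ‖c‖ + (m + n + 1 : ℕ) * (ε * ‖y‖)) := by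
    have := hA' y (D * D * (M + D * R ^ (m + n + 1)) * (ε ^ (m + n + 1) * ‖c‖ + (m + n + 1 : ℕ) * (ε * ‖y‖))) (fun w hw => by
      obtain ⟨hpole, herr⟩ := hrK w hw
      have hwz : dist ((ε : ℂ) * w) 0 < δ := by
        rw [dist_zero_right, norm_mul, hεn]
        calc ε * ‖w‖ ≤ ε * R := by gcongr; exact hR w hw
          _ < δ := (lt_div_iff₀ hR0).1 hε2
      obtain ⟨hQz, hQD, hvD, hPD⟩ := hδ' hwz
      have e1 := eval_eq_mul_value_of_not_isPole hq0 hpq hpole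
      have e2 := congrArg (Polynomial.eval ((ε : ℂ) * w)) hs
      simp only [Polynomial.eval_sub, Polynomial.eval_mul, Polynomial.eval_finsetSum,
        Polynomial.eval_C, Polynomial.eval_pow, Polynomial.eval_X] at e2
      have e3 : ∑ k, y k * w ^ (k : ℕ) = q.eval ((ε : ℂ) * w) * Q.eval ((ε : ℂ) * w) *
          ((value r ((ε : ℂ) * w) - f ((ε : ℂ) * w)) -
            (P.eval ((ε : ℂ) * w) / Q.eval ((ε : ℂ) * w) - f ((ε : ℂ) * w))) := by
        have : ∑ k, y k * w ^ (k : ℕ) = ∑ k, s k * ((ε : ℂ) * w) ^ (k : ℕ) :=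
          Finset.sum_congr rfl fun k _ => by rw [hy, mul_pow]; ring
        rw [this, ← e2, e1]
        field_simp
        ring
      have e4 : ‖q.eval ((ε : ℂ) * w)‖ ≤ D * (‖c‖ + ∑ k, ‖s k‖) := by
        rw [hqs, eval_perturb, mul_add, Finset.mul_sum]
        refine (norm_add_le _ _).trans (add_le_add ?_ ((norm_sum_le _ _).trans
          (Finset.sum_le_sum fun k _ => ?_)))
        · rw [Polynomial.eval_mul, Polynomial.eval_C, norm_mul, mul_comm]
          gcongr
        · rw [norm_mul, mul_comm]
          gcongr
          exact hvD k
      have e5 : ‖(value r ((ε : ℂ) * w) - f ((ε : ℂ) * w)) -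
            (P.eval ((ε : ℂ) * w) / Q.eval ((ε : ℂ) * w) - f ((ε : ℂ) * w))‖ ≤
          (M + D * R ^ (m + n + 1)) * ε ^ (m + n + 1) := by
        refine (norm_sub_le _ _).trans ?_
        rw [add_mul]
        refine add_le_add herr (hPD.trans ?_)
        rw [norm_mul, hεn, mul_pow, mul_comm (ε ^ (m + n + 1)), ← mul_assoc]
        gcongr
        exact hR w hw
      have e6 : ε ^ (m + n + 1) * (‖c‖ + ∑ k, ‖s k‖) ≤ ε ^ (m + n + 1) * ‖c‖ + (m + n + 1 : ℕ) * (ε * ‖y‖) := by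
        rw [mul_add, Finset.mul_sum]
        gcongr
        refine (Finset.sum_le_sum fun k _ => hsk k).trans ?_
        simp
      rw [e3, norm_mul, norm_mul]
      calc ‖q.eval ((ε : ℂ) * w)‖ * ‖Q.eval ((ε : ℂ) * w)‖ * _
          ≤ (D * (‖c‖ + ∑ k, ‖s k‖)) * D * ((M + D * R ^ (m + n + 1)) * ε ^ (m + n + 1)) := by gcongr
        _ = D * D * (M + D * R ^ (m + n + 1)) * (ε ^ (m + n + 1) * (‖c‖ + ∑ k, ‖s k‖)) := by ring
        _ ≤ _ := by gcongr)
    calc ‖y‖ ≤ _ := this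
      _ = _ := by rw [hW]; ring
  -- The bound on `ε` makes the coefficient of `‖y‖` on the right of `hyb` at most `1/2`, so that
  -- term is absorbed.
  have hyc : ‖y‖ ≤ 2 * W * (ε ^ (m + n + 1) * ‖c‖) := by
    have h1 : ε * (2 * (W * (m + n + 1 : ℕ) + 1)) ≤ 1 := by
      rw [lt_div_iff₀ (by positivity)] at hε3
      exact hε3.le
    nlinarith [norm_nonneg y]
  have hc : c ≠ 0 := by
    rintro rfl
    have hy0 : y = 0 := by
      rw [← norm_le_zero_iff]; simpa using hyc
    have hs0 : ∀ k, s k = 0 := fun k => by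
      have : y k = 0 := by rw [hy0]; rfl
      simpa [hy, hεc] using this
    apply hq0
    rw [hqs]
    simp [perturb, hs0]
  -- Dividing `p` and `q` by `c ≠ 0` normalizes the component along `(P, Q)` to `1`. The remaining
  -- division undoes the scaling in `scaledCoeff`.
  refine ⟨fun k => y k / (c * a * (ε : ℂ) ^ (m + n + 1)), ?_, ?_⟩
  · rw [mem_closedBall_zero_iff, pi_norm_le_iff_of_nonneg (by positivity)]
    intro k
    have hcn : 0 < ‖c‖ := norm_pos_iff.2 hc
    have han : 0 < ‖a‖ := norm_pos_iff.2 ha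
    rw [norm_div, norm_mul, norm_mul, norm_pow, hεn, 
      div_le_div_iff₀ (mul_pos (mul_pos hcn han) hεN) han]
    calc ‖y k‖ * ‖a‖ ≤ (2 * W * (ε ^ (m + n + 1) * ‖c‖)) * ‖a‖ := by
          gcongr; exact (norm_le_pi_norm y k).trans hyc
      _ = _ := by ring
  · have hco : ∀ k, Polynomial.C c *
        Polynomial.C (scaledCoeff a ε (fun k => y k / (c * a * (ε : ℂ) ^ (m + n + 1))) k) =
          Polynomial.C (s k) := by
      intro k
      rw [← Polynomial.C_mul]
      congr 1
      have h2 : (ε : ℂ) ^ (m + n + 1) = (ε : ℂ) ^ (m + n + 1 - (k : ℕ)) * (ε : ℂ) ^ (k : ℕ) := by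
        rw [← pow_add, Nat.sub_add_cancel k.2.le]
      simp only [scaledCoeff, hy]
      rw [h2]
      field_simp
    have hmul : ∀ (P : Polynomial ℂ) (u : Fin (m + n + 1) → Polynomial ℂ),
        perturb (Polynomial.C c * P) u s = Polynomial.C c *
          perturb P u (scaledCoeff a ε (fun k => y k / (c * a * (ε : ℂ) ^ (m + n + 1)))) := by
      intro P u
      simp only [perturb, mul_add, Finset.mul_sum, ← mul_assoc, hco]
    have hC : algebraMap (Polynomial ℂ) (RatFunc ℂ) (Polynomial.C c) ≠ 0 :=
      RatFunc.algebraMap_ne_zero (Polynomial.C_ne_zero.2 hc)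
    rw [hpq, hps, hqs, hmul, hmul, map_mul, map_mul, mul_div_mul_left _ _ hC]
    rfl

/-- Among the rational functions near the Padé approximant there is a best one. -/
theorem exists_isMinOn_uniformError_nearby {N : ℕ} {P Q : Polynomial ℂ}
    {u v : Fin N → Polynomial ℂ} {a : ℂ} {ε : ℝ} {L : Set ℂ} {f : ℂ → ℂ} {B : ℝ} (hB : 0 ≤ B)
    (hq : ∀ x ∈ Metric.closedBall (0 : Fin N → ℂ) B, ∀ z ∈ L,
      (perturb Q v (scaledCoeff a ε x)).eval z ≠ 0) :
    ∃ x₀ ∈ Metric.closedBall (0 : Fin N → ℂ) B,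
      ∀ x ∈ Metric.closedBall (0 : Fin N → ℂ) B,
        uniformError L f (nearby P Q u v a ε x₀) ≤ uniformError L f (nearby P Q u v a ε x) := by
  set F : (Fin N → ℂ) → ℝ≥0∞ := fun x => ⨆ z ∈ L,
    ‖(perturb P u (scaledCoeff a ε x)).eval z / (perturb Q v (scaledCoeff a ε x)).eval z - f z‖ₑ
    with hF
  have hFe : ∀ x ∈ Metric.closedBall (0 : Fin N → ℂ) B,
      uniformError L f (nearby P Q u v a ε x) = F x := by
    intro x hx
    rw [uniformError, hF]
    refine iSup_congr fun z => iSup_congr fun hz => ?_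
    obtain ⟨h1, h2⟩ := value_of_eq_div (r := nearby P Q u v a ε x) rfl (hq x hx z hz)
    rw [if_neg h1, h2]
  have hcont : ∀ (P : Polynomial ℂ) (u : Fin N → Polynomial ℂ) (z : ℂ),
      Continuous fun x : Fin N → ℂ => (perturb P u (scaledCoeff a ε x)).eval z := by
    intro P u z
    simp only [eval_perturb, scaledCoeff]
    fun_prop
  -- A supremum of continuous functions is lower semicontinuous, which suffices for a minimum on the
  -- compact ball.
  have hlsc : LowerSemicontinuousOn F (Metric.closedBall (0 : Fin N → ℂ) B) := by
    intro x hx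
    refine lowerSemicontinuousWithinAt_biSup fun z hz => ?_
    apply ContinuousWithinAt.lowerSemicontinuousWithinAt
    refine ContinuousWithinAt.enorm ?_
    exact (((hcont P u z).continuousWithinAt).div (hcont Q v z).continuousWithinAt
      (hq x hx z hz)).sub continuousWithinAt_const
  obtain ⟨x₀, hx₀, hmin⟩ := hlsc.exists_isMinOn ⟨0, by simp [hB]⟩ (isCompact_closedBall _ _)
  refine ⟨x₀, hx₀, fun x hx => ?_⟩
  rw [hFe x₀ hx₀, hFe x hx]
  exact hmin hx

/-! ### From zeros of a monic polynomial to zeros of `r - f` and interpolation nodes. -/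

theorem exists_roots_pow_add_sum {N : ℕ} (x : Fin N → ℂ) :
    ∃ Z : Multiset ℂ, Multiset.card Z = N ∧
      ∀ w : ℂ, w ^ N + ∑ k, x k * w ^ (k : ℕ) = (Z.map (fun ζ => w - ζ)).prod := by
  set S : Polynomial ℂ := ∑ k : Fin N, Polynomial.C (x k) * Polynomial.X ^ (k : ℕ) with hS
  have hdeg : S.degree < N := Polynomial.degree_sum_fin_lt x
  have hmonic : (Polynomial.X ^ N + S).Monic := Polynomial.monic_X_pow_add hdeg
  have hnat : (Polynomial.X ^ N + S).natDegree = N := by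
    apply Polynomial.natDegree_eq_of_degree_eq_some
    rw [Polynomial.degree_add_eq_left_of_degree_lt (by simpa using hdeg), Polynomial.degree_X_pow]
  have hsplit := IsAlgClosed.splits (Polynomial.X ^ N + S)
  refine ⟨(Polynomial.X ^ N + S).roots, ?_, fun w => ?_⟩
  · rw [← hsplit.natDegree_eq_card_roots, hnat]
  · have := hsplit.eval_eq_prod_roots w
    rw [hmonic.leadingCoeff, one_mul] at this
    rw [← this]
    simp [hS, Polynomial.eval_finsetSum]

theorem exists_coeffs_prod_sub {N : ℕ} (ζ : Fin N → ℂ) :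
    ∃ x : Fin N → ℂ, ∀ w : ℂ, w ^ N + ∑ k, x k * w ^ (k : ℕ) = ∏ j, (w - ζ j) := by
  set T : Polynomial ℂ := ∏ j, (Polynomial.X - Polynomial.C (ζ j)) with hT
  have hmonic : T.Monic := Polynomial.monic_prod_of_monic _ _ fun j _ => Polynomial.monic_X_sub_C _
  have hnat : T.natDegree = N := by
    rw [hT, Polynomial.natDegree_finsetProd_X_sub_C_eq_card]; simp
  refine ⟨fun k => T.coeff k, fun w => ?_⟩
  have h1 := congrArg (Polynomial.eval w) hmonic.as_sum
  rw [hnat, ← Fin.sum_univ_eq_sum_range (fun i => Polynomial.C (T.coeff i) * Polynomial.X ^ i)] at h1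
  simp only [Polynomial.eval_add, Polynomial.eval_finsetSum, Polynomial.eval_mul,
    Polynomial.eval_pow, Polynomial.eval_X, Polynomial.eval_C] at h1
  rw [← h1, hT, Polynomial.eval_prod]
  simp

theorem pow_card_le_norm_prod_sub {Z : Multiset ℂ} {w : ℂ} {d : ℝ} (hd : 0 ≤ d)
    (h : ∀ ζ ∈ Z, d ≤ ‖w - ζ‖) :
    d ^ Multiset.card Z ≤ ‖(Z.map (fun ζ => w - ζ)).prod‖ := by
  induction Z using Multiset.induction_on with
  | empty => simp
  | cons b Z ih =>
    rw [Multiset.card_cons, pow_succ', Multiset.map_cons, Multiset.prod_cons, norm_mul]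
    exact mul_le_mul (h b (by simp)) (ih fun ζ hζ => h ζ (by simp [hζ])) (by positivity)
      (norm_nonneg _)

theorem differentiableOn_value_sub {E : Set ℂ} {f : ℂ → ℂ} (hf : DifferentiableOn ℂ f E)
    {r : RatFunc ℂ} {p q : Polynomial ℂ}
    (hr : r = algebraMap (Polynomial ℂ) (RatFunc ℂ) p / algebraMap (Polynomial ℂ) (RatFunc ℂ) q) :
    DifferentiableOn ℂ (fun z => value r z - f z) (E ∩ {z | q.eval z ≠ 0}) := by
  refine DifferentiableOn.sub ?_ (hf.mono Set.inter_subset_left)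
  refine (p.differentiable.differentiableOn.div q.differentiable.differentiableOn
    fun z hz => hz.2).congr fun z hz => (value_of_eq_div hr hz.2).2

/-- If `r - f` has `m + n + 1` zeros in a disc without poles, then `r` is a Newton-Padé approximant
with nodes in this disc. -/
theorem mem_interpolants_of_hasExactlyZeros {E : Set ℂ} (hE : IsOpen E) {f : ℂ → ℂ}
    (hf : DifferentiableOn ℂ f E) {m n : ℕ} {r : RatFunc ℂ} {p q : Polynomial ℂ}
    (hr : IsQuotient m n r p q) {D : Set ℂ} (hDE : D ⊆ E) (hq : ∀ z ∈ D, q.eval z ≠ 0)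
    (hz : HasExactlyZeros (fun z => value r z - f z) D (m + n + 1)) :
    r ∈ interpolants E f m n D := by
  obtain ⟨Z, hcard, hZD, hZ⟩ := hz
  have hE' : IsOpen (E ∩ {z | q.eval z ≠ 0}) :=
    hE.inter (isOpen_ne_fun q.continuous continuous_const)
  have hd : DifferentiableOn ℂ (fun w => p.eval w - q.eval w * f w) E :=
    p.differentiable.differentiableOn.sub (q.differentiable.differentiableOn.mul hf)
  obtain ⟨v, hv, hv'⟩ := exists_eq_mul_multiset_prod hE Z hd (fun z hz => hDE (hZD z hz)) (by
    intro z hz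
    have hzD := hZD z hz
    rw [← hZ z hzD]
    have hnhds := hE'.mem_nhds (⟨hDE hzD, hq z hzD⟩ : z ∈ E ∩ {z | q.eval z ≠ 0})
    have ha1 : AnalyticAt ℂ (fun z => value r z - f z) z :=
      (differentiableOn_value_sub hf hr.2.2.2).analyticAt hnhds
    have ha2 : AnalyticAt ℂ (fun z => q.eval z) z := q.differentiable.analyticAt z
    -- The linearized error is `q (r - f)`, so it vanishes at least to the order of `r - f`.
    have : (fun w => p.eval w - q.eval w * f w) =ᶠ[𝓝 z]
        (fun z => q.eval z) * fun z => value r z - f z := by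
      filter_upwards [hnhds] with w hw
      have hw2 : q.eval w ≠ 0 := hw.2
      rw [Pi.mul_apply, (value_of_eq_div hr.2.2.2 hw2).2]
      field_simp
    rw [analyticOrderAt_congr this, analyticOrderAt_mul ha2 ha1]
    exact le_add_self)
  obtain ⟨ζ, hζ⟩ := exists_fin_map_eq_multiset Z hcard
  have hmem : ∀ j, ζ j ∈ D := fun j => hZD _ (by
    rw [← hζ]; exact Multiset.mem_map_of_mem _ (Finset.mem_univ j))
  refine ⟨ζ, hmem, fun j => hDE (hmem j), p, q, hr, v, hv, fun w hw => ?_⟩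
  rw [hv' w hw, ← hζ, Multiset.map_map]
  rfl

theorem interpolants_subset_rationals {E : Set ℂ} {f : ℂ → ℂ} {m n : ℕ} {D : Set ℂ} :
    interpolants E f m n D ⊆ rationals m n := by
  rintro r ⟨_, _, _, p, q, hpq, _⟩
  exact ⟨p, q, hpq⟩

/-- If the error of `r` on a disc of radius `ε ρ` is close to a multiple of a scaled monic polynomial
whose zeros stay away from the boundary, then it has as many zeros as this polynomial. -/
theorem hasExactlyZeros_of_norm_sub_le {E : Set ℂ} (hE : IsOpen E) {g : ℂ → ℂ}
    (hg : DifferentiableOn ℂ g E) {ε ρ d η : ℝ} (hε : 0 < ε) (hρ : 0 < ρ) (hd : 0 < d)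
    (hρE : Metric.closedBall 0 (ε * ρ) ⊆ E) {a : ℂ} (ha : a ≠ 0) {Z : Multiset ℂ}
    (hZ : ∀ ζ ∈ Z, ‖ζ‖ ≤ ρ - d) (hη : η < ‖a‖ * d ^ Multiset.card Z)
    (h : ∀ w ∈ Metric.closedBall (0 : ℂ) ρ, ‖g ((ε : ℂ) * w) - a * (ε : ℂ) ^ Multiset.card Z *
      (Z.map (fun ζ => w - ζ)).prod‖ ≤ η * ε ^ Multiset.card Z) :
    HasExactlyZeros g (Metric.closedBall 0 (ε * ρ)) (Multiset.card Z) := by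
  have hεc : (ε : ℂ) ≠ 0 := by exact_mod_cast hε.ne'
  have hεn : ‖(ε : ℂ)‖ = ε := by rw [Complex.norm_real, Real.norm_of_nonneg hε.le]
  -- The comparison polynomial in `z = εw` has the zeros `εζ`. On `‖w‖ = ρ` each factor `w - ζ` has
  -- modulus at least `d`, which makes it dominate the error `η ε^N`.
  have key := hasExactlyZeros_of_norm_sub_lt hE (mul_pos hε hρ) hρE hg ha
    (Z := Z.map fun ζ => (ε : ℂ) * ζ) ?_ ?_
  · rwa [Multiset.card_map] at key
  · intro z hz
    obtain ⟨ζ, hζ, rfl⟩ := Multiset.mem_map.1 hz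
    rw [mem_ball_zero_iff, norm_mul, hεn]
    have := hZ ζ hζ
    gcongr
    linarith
  · intro z hz
    obtain ⟨w, rfl⟩ : ∃ w, z = (ε : ℂ) * w := ⟨z / ε, by field_simp⟩
    have hw : ‖w‖ = ρ := by
      rw [mem_sphere_zero_iff_norm, norm_mul, hεn] at hz
      exact mul_left_cancel₀ hε.ne' hz
    have hprod : ((Z.map fun ζ => (ε : ℂ) * ζ).map fun ζ => (ε : ℂ) * w - ζ).prod =
        (ε : ℂ) ^ Multiset.card Z * (Z.map (fun ζ => w - ζ)).prod := by
      have : ((Z.map fun ζ => (ε : ℂ) * ζ).map fun ζ => (ε : ℂ) * w - ζ) =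
          Z.map fun ζ => (ε : ℂ) * (w - ζ) := by
        rw [Multiset.map_map]
        exact Multiset.map_congr rfl fun ζ _ => (mul_sub _ _ _).symm
      rw [this, Multiset.prod_map_mul, Multiset.map_const', Multiset.prod_replicate]
    rw [hprod, ← mul_assoc]
    refine (h w (by simp [hw])).trans_lt ?_
    rw [norm_mul, norm_mul, norm_pow, hεn]
    have h1 := pow_card_le_norm_prod_sub (w := w) hd.le (fun ζ hζ => by
      have h2 := norm_sub_norm_le w ζ
      have := hZ ζ hζ
      rw [hw] at h2
      linarith)
    calc η * ε ^ Multiset.card Z < ‖a‖ * d ^ Multiset.card Z * ε ^ Multiset.card Z := by gcongr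
      _ = ‖a‖ * ε ^ Multiset.card Z * d ^ Multiset.card Z := by ring
      _ ≤ _ := by gcongr

/-! ### Best approximants on small sets `εK`. -/

section

open Metric

theorem forall_mem_smul_iff {ε : ℂ} {K : Set ℂ} {p : ℂ → Prop} :
    (∀ z ∈ ε • K, p z) ↔ ∀ w ∈ K, p (ε * w) := by
  constructor
  · intro h w hw
    exact h _ (Set.smul_mem_smul_set hw)
  · rintro h _ ⟨w, hw, rfl⟩
    exact h w hw

/-- For small `ε`, a best rational approximant on `ε K` exists, and each one has exactly `m + n + 1`
interpolation points in the disc of radius `ε ρ`. -/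
theorem IsLocalFrame.eventually_isChebyshev {m n : ℕ} {P Q : Polynomial ℂ}
    {u v : Fin (m + n + 1) → Polynomial ℂ} (h : IsLocalFrame m n P Q u v) {E : Set ℂ}
    (hE : IsOpen E) (h0E : (0 : ℂ) ∈ E) {f : ℂ → ℂ} (hf : DifferentiableOn ℂ f E) {a : ℂ}
    (ha : a ≠ 0)
    (hPf : (fun z : ℂ => P.eval z / Q.eval z - f z - a * z ^ (m + n + 1)) =o[𝓝 0]
      fun z : ℂ => z ^ (m + n + 1)) {K : Set ℂ} (hK : IsCompact K) (hKi : K.Infinite) {R ρ : ℝ}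
    (hR : ∀ z ∈ K, ‖z‖ ≤ R) (hρ0 : 0 < ρ)
    (hρ : ρ = 2 * (chebyshevConst K (m + n + 1) / chebyshevConst K (m + n)) + R) :
    ∀ᶠ ε : ℝ in 𝓝[>] 0, closedBall 0 (ε * ρ) ⊆ E ∧
      (∃ r, IsChebyshev m n ((ε : ℂ) • K) f r) ∧
      ∀ r, IsChebyshev m n ((ε : ℂ) • K) f r →
        HasExactlyZeros (fun z => value r z - f z) (closedBall 0 (ε * ρ)) (m + n + 1) ∧
          r ∈ interpolants E f m n (closedBall 0 (ε * ρ)) := by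
  have ht := chebyshevConst_pos hK hKi (m + n + 1)
  have ht' := chebyshevConst_pos hK hKi (m + n)
  -- The budget between `t` and the `2 t` allowed by `ρ`: trial nodes give `5/4`, the error `η` adds
  -- `1/4` to reach `M`, and passing back to the monic polynomial adds another `1/4`. The resulting
  -- `7/4` leaves the gap `d = t / (4 t')` between the zeros and the circle of radius `ρ`.
  obtain ⟨ζ, hζ⟩ := exists_nodal_lt_of_chebyshevConst_lt hK
    (show chebyshevConst K (m + n + 1) < 5 / 4 * chebyshevConst K (m + n + 1) by linarith)
  set t := chebyshevConst K (m + n + 1)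
  set t' := chebyshevConst K (m + n)
  have han : 0 < ‖a‖ := norm_pos_iff.2 ha
  set d : ℝ := t / (4 * t') with hd
  have hd0 : 0 < d := by positivity
  -- The first bound serves the comparison on `K`, the second Rouché's theorem on the circle.
  set η : ℝ := min (‖a‖ * t / 4) (‖a‖ * d ^ (m + n + 1) / 2) with hη
  have hη0 : 0 < η := lt_min (by positivity) (by positivity)
  have hη1 : η ≤ ‖a‖ * t / 4 := min_le_left _ _
  have hη2 : η < ‖a‖ * d ^ (m + n + 1) := (min_le_right _ _).trans_lt (half_lt_self (by positivity))
  obtain ⟨x₀, hx₀⟩ := exists_coeffs_prod_sub ζ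
  have hPfO : (fun z : ℂ => P.eval z / Q.eval z - f z) =O[𝓝 0] fun z : ℂ => z ^ (m + n + 1) := by
    simpa using hPf.isBigO.add ((Asymptotics.isBigO_refl (fun z : ℂ => z ^ (m + n + 1))
      (𝓝 0)).const_mul_left a)
  set M : ℝ := ‖a‖ * (3 / 2 * t) with hM
  have hM0 : 0 ≤ M := by positivity
  obtain ⟨B, hB⟩ := h.exists_eventually_eq_nearby ha hPfO hKi hK.isBounded hM0
  set B' := max B ‖x₀‖
  have hB'0 : 0 ≤ B' := (norm_nonneg _).trans (le_max_right _ _)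
  obtain ⟨δ, hδ, hδE⟩ := isOpen_iff.1 hE 0 h0E
  have hKρ : ∀ w ∈ K, w ∈ closedBall (0 : ℂ) ρ := fun w hw => by
    rw [mem_closedBall_zero_iff, hρ]
    have : 0 < 2 * (t / t') := by positivity
    linarith [hR w hw]
  filter_upwards [self_mem_nhdsWithin, hB, h.eventually_norm_nearby_sub_le hPf B' ρ hη0,
    nhdsWithin_le_nhds (gt_mem_nhds (div_pos hδ hρ0))] with ε hε hεB hεm hεδ
  have hε : 0 < ε := hε
  have hεn : ‖(ε : ℂ)‖ = ε := by rw [Complex.norm_real, Real.norm_of_nonneg hε.le]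
  have hεN : 0 < ε ^ (m + n + 1) := by positivity
  have hDE : closedBall 0 (ε * ρ) ⊆ E :=
    (closedBall_subset_ball ((lt_div_iff₀ hρ0).1 hεδ)).trans hδE
  have hD : ∀ z ∈ closedBall (0 : ℂ) (ε * ρ), ∃ w ∈ closedBall (0 : ℂ) ρ, z = (ε : ℂ) * w := by
    intro z hz
    have hεc : (ε : ℂ) ≠ 0 := by exact_mod_cast hε.ne'
    refine ⟨z / ε, ?_, by field_simp⟩
    rw [mem_closedBall_zero_iff] at hz ⊢
    rw [norm_div, hεn, div_le_iff₀ hε]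
    linarith
  set nb := nearby P Q u v a ε with hnb
  have hval : ∀ x ∈ closedBall (0 : Fin (m + n + 1) → ℂ) B', ∀ w ∈ closedBall (0 : ℂ) ρ,
      ¬ IsPole (nb x) ((ε : ℂ) * w) ∧
      ‖value (nb x) ((ε : ℂ) * w) - f ((ε : ℂ) * w) -
        a * (ε : ℂ) ^ (m + n + 1) * (w ^ (m + n + 1) + ∑ k, x k * w ^ (k : ℕ))‖
          ≤ η * ε ^ (m + n + 1) := by
    intro x hx w hw
    obtain ⟨h1, h2⟩ := hεm x hx w hw
    obtain ⟨h3, h4⟩ := value_of_eq_div (r := nb x) rfl h1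
    rw [h4]
    exact ⟨h3, h2⟩
  have hquot : ∀ x ∈ closedBall (0 : Fin (m + n + 1) → ℂ) B',
      IsQuotient m n (nb x) (perturb P u (scaledCoeff a ε x)) (perturb Q v (scaledCoeff a ε x)) := by
    intro x hx
    refine h.isQuotient_nearby fun h0 => (hεm x hx 0 (by simp [hρ0.le])).1 ?_
    rw [h0, Polynomial.eval_zero]
  have hrat : ∀ x ∈ closedBall (0 : Fin (m + n + 1) → ℂ) B', nb x ∈ rationals m n :=
    fun x hx => ⟨_, _, hquot x hx⟩
  have herr : ∀ r : RatFunc ℂ,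
      uniformError ((ε : ℂ) • K) f r ≤ ENNReal.ofReal (M * ε ^ (m + n + 1)) ↔
        ∀ w ∈ K, ¬ IsPole r ((ε : ℂ) * w) ∧
          ‖value r ((ε : ℂ) * w) - f ((ε : ℂ) * w)‖ ≤ M * ε ^ (m + n + 1) := by
    intro r
    rw [uniformError_le_ofReal_iff (by positivity), forall_mem_smul_iff]
  have hx₀B : x₀ ∈ closedBall (0 : Fin (m + n + 1) → ℂ) B' := by simp [B']
  have htrial : uniformError ((ε : ℂ) • K) f (nb x₀) ≤ ENNReal.ofReal (M * ε ^ (m + n + 1)) := by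
    rw [herr]
    intro w hw
    obtain ⟨h1, h2⟩ := hval x₀ hx₀B w (hKρ w hw)
    refine ⟨h1, ?_⟩
    have h3 : ‖a * (ε : ℂ) ^ (m + n + 1) * (w ^ (m + n + 1) + ∑ k, x₀ k * w ^ (k : ℕ))‖ ≤
        ‖a‖ * ε ^ (m + n + 1) * (5 / 4 * t) := by
      rw [hx₀, norm_mul, norm_mul, norm_pow, hεn, norm_prod]
      have := hζ w hw
      gcongr
    have h4 := norm_le_norm_sub_add (value (nb x₀) ((ε : ℂ) * w) - f ((ε : ℂ) * w))
      (a * (ε : ℂ) ^ (m + n + 1) * (w ^ (m + n + 1) + ∑ k, x₀ k * w ^ (k : ℕ)))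
    have h5 : η * ε ^ (m + n + 1) ≤ ‖a‖ * t / 4 * ε ^ (m + n + 1) := by gcongr
    calc _ ≤ ‖a‖ * t / 4 * ε ^ (m + n + 1) + ‖a‖ * ε ^ (m + n + 1) * (5 / 4 * t) := by linarith
      _ = M * ε ^ (m + n + 1) := by rw [hM]; ring
  have hnear : ∀ r ∈ rationals m n,
      uniformError ((ε : ℂ) • K) f r ≤ ENNReal.ofReal (M * ε ^ (m + n + 1)) →
        ∃ x ∈ closedBall (0 : Fin (m + n + 1) → ℂ) B', r = nb x := by
    intro r hr hle
    obtain ⟨x, hx, hrx⟩ := hεB r hr ((herr r).1 hle)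
    exact ⟨x, closedBall_subset_closedBall (le_max_left _ _) hx, hrx⟩
  refine ⟨hDE, ?_, fun r hr => ?_⟩
  · obtain ⟨x₁, hx₁, hmin⟩ := exists_isMinOn_uniformError_nearby (P := P) (u := u) (f := f)
      (L := (ε : ℂ) • K) hB'0 (fun x hx => forall_mem_smul_iff.2 fun w hw =>
        (hεm x hx w (hKρ w hw)).1)
    refine ⟨nb x₁, hrat x₁ hx₁, fun s hs => ?_⟩
    -- A competitor either has error below the threshold and so belongs to the compact family, or is
    -- no better than the trial function `nb x₀`.
    rcases le_total (uniformError ((ε : ℂ) • K) f s) (ENNReal.ofReal (M * ε ^ (m + n + 1)))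
      with hle | hle
    · obtain ⟨x, hx, rfl⟩ := hnear s hs hle
      exact hmin x hx
    · exact (hmin x₀ hx₀B).trans (htrial.trans hle)
  · have hle := (hr.2 _ (hrat x₀ hx₀B)).trans htrial
    obtain ⟨x, hx, rfl⟩ := hnear r hr.1 hle
    have hq : ∀ z ∈ closedBall (0 : ℂ) (ε * ρ),
        (perturb Q v (scaledCoeff a ε x)).eval z ≠ 0 := by
      intro z hz
      obtain ⟨w, hw, rfl⟩ := hD z hz
      exact (hεm x hx w hw).1
    obtain ⟨Z, hZ, hZp⟩ := exists_roots_pow_add_sum x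
    have hroots : ∀ ξ ∈ Z, ‖ξ‖ ≤ ρ - d := by
      intro ξ hξ
      have hbd : ∀ w ∈ K, ‖(Z.map (fun ξ => w - ξ)).prod‖ ≤ 7 / 4 * t := by
        intro w hw
        have h1 := ((herr _).1 hle w hw).2
        have h2 := (hval x hx w (hKρ w hw)).2
        have h3 := norm_le_norm_add_norm_sub (value (nb x) ((ε : ℂ) * w) - f ((ε : ℂ) * w))
          (a * (ε : ℂ) ^ (m + n + 1) * (w ^ (m + n + 1) + ∑ k, x k * w ^ (k : ℕ)))
        rw [hZp, norm_mul, norm_mul, norm_pow, hεn, ← hZp] at h3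
        have h5 : η * ε ^ (m + n + 1) ≤ ‖a‖ * t / 4 * ε ^ (m + n + 1) := by gcongr
        have h6 : ‖a‖ * ε ^ (m + n + 1) * ‖w ^ (m + n + 1) + ∑ k, x k * w ^ (k : ℕ)‖ ≤
            ‖a‖ * ε ^ (m + n + 1) * (7 / 4 * t) := by
          calc _ ≤ M * ε ^ (m + n + 1) + ‖a‖ * t / 4 * ε ^ (m + n + 1) := by linarith
            _ = _ := by rw [hM]; ring
        rw [← hZp]
        exact le_of_mul_le_mul_left h6 (by positivity)
      refine (norm_root_le_of_nodal_le hK hKi hR hZ hbd hξ).trans (le_of_eq ?_)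
      change R + 7 / 4 * t / t' = ρ - d
      rw [hρ, hd]
      field_simp
      ring
    have hzeros : HasExactlyZeros (fun z => value (nb x) z - f z) (closedBall 0 (ε * ρ))
        (m + n + 1) := by
      rw [← hZ]
      -- The zeros of the denominator are removed from `E`, since `r - f` is known to be holomorphic
      -- only off them. The closed disc contains none.
      refine hasExactlyZeros_of_norm_sub_le
        (hE.inter (isOpen_ne_fun (perturb Q v (scaledCoeff a ε x)).continuous continuous_const))
        (differentiableOn_value_sub hf rfl) hε hρ0 hd0 (fun z hz => ⟨hDE hz, hq z hz⟩) ha hroots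
        (by rw [hZ]; exact hη2) fun w hw => ?_
      rw [hZ, ← hZp]
      exact (hval x hx w hw).2
    exact ⟨hzeros, mem_interpolants_of_hasExactlyZeros hE hf (hquot x hx) hDE hq hzeros⟩

end

end RationalApprox

end

theorem mainTheorem2
    (E : Set ℂ) (hE : IsOpen E) (h0E : (0 : ℂ) ∈ E)
    (f : ℂ → ℂ) (hf : DifferentiableOn ℂ f E)
    (K : Set ℂ) (hKE : K ⊆ E) (hKc : IsCompact K) (hKne : K.Nonempty) (hKp : Preperfect K)
    (m n : ℕ)
    (rP : RatFunc ℂ) (hrP : RationalApprox.IsPade E f m n rP)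
    (hnd : RationalApprox.IsNondegenerate m n rP)
    (a : ℂ) (ha : RationalApprox.IsErrorCoeff f m n rP a) (ha0 : a ≠ 0)
    (ρ : ℝ) (hρ : ρ = RationalApprox.nodeRadius K m n)
    (Θ : Set ℂ) (hΘ : Θ = Metric.closedBall 0 ρ) :
    0 < ρ ∧
    ∃ ε₀ : ℝ, 0 < ε₀ ∧ ∀ ε : ℝ, 0 < ε → ε < ε₀ →
      (ε : ℂ) • K ⊆ E ∧ (ε : ℂ) • Θ ⊆ E ∧
      (∀ r : RatFunc ℂ, RationalApprox.IsChebyshev m n ((ε : ℂ) • K) f r →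
        RationalApprox.HasExactlyZeros (fun z => RationalApprox.value r z - f z)
          ((ε : ℂ) • Θ) (m + n + 1)) ∧
      (∀ r : RatFunc ℂ, RationalApprox.IsChebyshev m n ((ε : ℂ) • K) f r ↔
        RationalApprox.IsInterpolatoryBest E m n ((ε : ℂ) • Θ) ((ε : ℂ) • K) f r) := by
  have hKi := RationalApprox.infinite_of_preperfect hKne hKp
  have ht := RationalApprox.chebyshevConst_pos hKc hKi (m + n + 1)
  have ht' := RationalApprox.chebyshevConst_pos hKc hKi (m + n)
  have hR : ∀ z ∈ K, ‖z‖ ≤ ⨆ z : K, ‖(z : ℂ)‖ := fun z hz => by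
    refine le_ciSup (f := fun z : K => ‖(z : ℂ)‖) ?_ ⟨z, hz⟩
    have := hKc.bddAbove_image (f := fun z : ℂ => ‖z‖) (by fun_prop)
    rwa [Set.image_eq_range] at this
  have hR0 : 0 ≤ ⨆ z : K, ‖(z : ℂ)‖ := Real.iSup_nonneg fun z => norm_nonneg _
  have hρ0 : 0 < ρ := by
    rw [hρ, RationalApprox.nodeRadius]
    have := div_pos ht ht'
    linarith
  refine ⟨hρ0, ?_⟩
  have hfc : ContinuousAt f 0 := (hf.differentiableAt (hE.mem_nhds h0E)).continuousAt
  obtain ⟨P, Q, hPQ, hP, hQ, hQ0, hdeg, hrPQ⟩ := RationalApprox.exists_coprime_of_isNondegenerate hnd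
    (RationalApprox.denom_eval_zero_ne_zero hfc ha)
  obtain ⟨u, v, hframe⟩ := RationalApprox.exists_isLocalFrame hPQ hQ0 hP hQ hdeg
  have hQne : ∀ᶠ z in 𝓝 (0 : ℂ), Q.eval z ≠ 0 :=
    Q.continuous.continuousAt.eventually_ne (by rw [hQ0]; exact one_ne_zero)
  have hPf : (fun z : ℂ => P.eval z / Q.eval z - f z - a * z ^ (m + n + 1)) =o[𝓝 0]
      fun z : ℂ => z ^ (m + n + 1) := by
    refine (ha.trans_isLittleO (Asymptotics.isLittleO_pow_pow (Nat.lt_succ_self _))).congr' ?_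
      Filter.EventuallyEq.rfl
    filter_upwards [hQne] with z hz
    rw [(RationalApprox.value_of_eq_div hrPQ hz).2]
  have hev := hframe.eventually_isChebyshev hE h0E hf ha0 hPf hKc hKi hR hρ0 hρ
  obtain ⟨ε₀, hε₀, hsub⟩ := mem_nhdsGT_iff_exists_Ioo_subset.1 hev
  refine ⟨ε₀, hε₀, fun ε hε hlt => ?_⟩
  obtain ⟨hDE, ⟨r₀, hr₀⟩, hcheb⟩ := hsub ⟨hε, hlt⟩
  have hΘε : (ε : ℂ) • Θ = Metric.closedBall 0 (ε * ρ) := by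
    rw [hΘ, smul_closedBall _ _ hρ0.le, smul_zero, Complex.norm_real, Real.norm_of_nonneg hε.le]
  have hKΘ : K ⊆ Θ := fun z hz => by
    rw [hΘ, mem_closedBall_zero_iff, hρ, RationalApprox.nodeRadius]
    have := div_pos ht ht'
    linarith [hR z hz]
  have hΘE : (ε : ℂ) • Θ ⊆ E := hΘε ▸ hDE
  refine ⟨(Set.smul_set_mono hKΘ).trans hΘE, hΘE, fun r hr => ?_, fun r => ⟨fun hr => ?_, fun hr => ?_⟩⟩
  · rw [hΘε]; exact (hcheb r hr).1
  · refine ⟨?_, fun s hs => hr.2 s (RationalApprox.interpolants_subset_rationals hs)⟩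
    rw [hΘε]; exact (hcheb r hr).2
  · refine ⟨RationalApprox.interpolants_subset_rationals hr.1, fun s hs => ?_⟩
    -- Some Chebyshev approximant `r₀` exists and is itself an interpolant, so being at least as
    -- good as `r₀` makes `r` optimal among all rational functions.
    have h0 : r₀ ∈ RationalApprox.interpolants E f m n ((ε : ℂ) • Θ) := by
      rw [hΘε]; exact (hcheb r₀ hr₀).2
    exact (hr.2 r₀ h0).trans (hr₀.2 s hs)
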